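/- All manifolds and vector bundles are smooth, real and of finite constant dimension resp. rank. **Setting.** Let $(V\rightrightarrows E;\,G\rightrightarrows M)$ be an $\mathcal{LA}$-groupoid with $M$ Hausdorff and $\sigma$-compact. That is: $G\rightrightarrows M$ and $V\rightrightarrows E$ are Lie groupoids, with source and target maps $s,t$ and $\tilde s,\tilde t$; $V\to G$ and $E\to M$ are vector bundles; all structure maps of $V\rightrightarrows E$ (source, target, unit, inversion, multiplication) are vector bundle morphisms over the corresponding structure maps of $G\rightrightarrows M$ (so that $V$ is a VB-groupoid); $V\to G$ and $E\to M$ carry Lie algebroid structures; and all structure maps of $V\rightrightarrows E$ are Lie algebroid morphisms, where the multiplication is defined on the fibre-product Lie algebroid $V\times_E V\to G\times_M G$. Let $C=\ker(\tilde s)|_M$ (the restriction along the units $M\subset G$) be the core and $\partial=\tilde t|_C\colon C\to E$ the core-anchor map. Assume that $\partial$ is injective, and identify $C$ with the subbundle $\partial(C)\subset E$ and $\Gamma(C)$ with a subspace of $\Gamma(E)$. Then $\Gamma(C)$ is a Lie subalgebra of $\Gamma(E)$. Put $N_0=E/C$ and $N_1=V/(\ker\tilde s+\ker\tilde t)$,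 and write $\overline Y\in\Gamma(N_0)$ for the class of $Y\in\Gamma(E)$. The maps $\tilde s,\tilde t$ induce fibrewise invertible vector bundle morphisms $N_1\to N_0$ over $s$ and $t$, and hence pullback maps $\tilde s^*,\tilde t^*\colon\Gamma(N_0)\to\Gamma(N_1)$. * A section $\lambda\in\Gamma(N_0)$ is *basic* if $\tilde s^*\lambda=\tilde t^*\lambda$; the vector space of basic sections is $\Gamma_{\mathrm{bas}}(V)\subset\Gamma(E/C)$. * The *Bott representation* of $C$ on $N_0$ is $\nabla_X\overline Y=\overline{[X,Y]}$ for $X\in\Gamma(C)$, $Y\in\Gamma(E)$, and $\Gamma_0(E)=\{\lambda\in\Gamma(N_0) : \nabla_X\lambda=0 \text{ for all } X\in\Gamma(C)\}$ is the space of *Bott-flat sections*, a Lie algebra under $[\overline X,\overline Y]=\overline{[X,Y]}$. * $N(\Gamma(C))$ is the normalizer of $\Gamma(C)$ in the Lie algebra $\Gamma(E)$. **Proposition.** The map $X\mapsto\overline X$ induces an isomorphism of Lie algebras $$N(\Gamma(C))/\Gamma(C)\;\cong\;\Gamma_0(E),$$ every basic section is Bott-flat, i.e. $\Gamma_{\mathrm{bas}}(V)\subset\Gamma_0(E)$,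 and $\Gamma_{\mathrm{bas}}(V)$ is a Lie subalgebra of $\Gamma_0(E)$. -/

import Mathlib

open Bundle Set Manifold
open scoped Manifold ContDiff Topology

set_option linter.unusedSectionVars false

/-! ### Groupoids and Lie groupoids -/

/-- A groupoid with set of arrows `G` and set of objects `M`.  The composition `comp g h` is defined
when `src g = tgt h`, that is `comp g h` is `g` after `h`. -/
structure AlgGroupoid (G M : Type*) where
  src : G → M
  tgt : G → M
  unit : M → G
  inv : G → G
  comp : ∀ g h : G, src g = tgt h → G
  src_unit : ∀ x, src (unit x) = x
  tgt_unit : ∀ x, tgt (unit x) = x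
  src_inv : ∀ g, src (inv g) = tgt g
  tgt_inv : ∀ g, tgt (inv g) = src g
  src_comp : ∀ g h w, src (comp g h w) = src h
  tgt_comp : ∀ g h w, tgt (comp g h w) = tgt g
  unit_comp : ∀ g w, comp (unit (tgt g)) g w = g
  comp_unit : ∀ g w, comp g (unit (src g)) w = g
  inv_comp : ∀ g w, comp (inv g) g w = unit (src g)
  comp_inv : ∀ g w, comp g (inv g) w = unit (tgt g)
  comp_assoc : ∀ g h k w₁ w₂ w₃ w₄, comp (comp g h w₁) k w₂ = comp g (comp h k w₃) w₄

namespace AlgGroupoid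

variable {G M : Type*} (𝒢 : AlgGroupoid G M)

theorem comp_congr {g g' h h' : G} (hg : g = g') (hh : h = h') (w : 𝒢.src g = 𝒢.tgt h)
    (w' : 𝒢.src g' = 𝒢.tgt h') : 𝒢.comp g h w = 𝒢.comp g' h' w' := by
  subst hg; subst hh; rfl

theorem comp_right_cancel {g g' h : G} (w : 𝒢.src g = 𝒢.tgt h) (w' : 𝒢.src g' = 𝒢.tgt h)
    (e : 𝒢.comp g h w = 𝒢.comp g' h w') : g = g' := by
  have key : ∀ (a : G) (wa : 𝒢.src a = 𝒢.tgt h),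
      𝒢.comp (𝒢.comp a h wa) (𝒢.inv h) (by rw [𝒢.src_comp, 𝒢.tgt_inv]) = a := by
    intro a wa
    have w1 : 𝒢.src h = 𝒢.tgt (𝒢.inv h) := (𝒢.tgt_inv h).symm
    rw [𝒢.comp_assoc a h (𝒢.inv h) wa _ w1 (by rw [𝒢.tgt_comp]; exact wa)]
    have h2 : 𝒢.comp h (𝒢.inv h) w1 = 𝒢.unit (𝒢.src a) := by rw [𝒢.comp_inv, wa]
    rw [𝒢.comp_congr rfl h2 _ (𝒢.tgt_unit _).symm, 𝒢.comp_unit]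
  rw [← key g w, ← key g' w']
  exact 𝒢.comp_congr e rfl _ _

theorem inv_eq_of_comp {g h : G} (w : 𝒢.src g = 𝒢.tgt h) (e : 𝒢.comp g h w = 𝒢.unit (𝒢.src h)) :
    𝒢.inv h = g :=
  𝒢.comp_right_cancel (h := h) (𝒢.src_inv h) w ((𝒢.inv_comp h _).trans e.symm)

theorem inv_unit (x : M) : 𝒢.inv (𝒢.unit x) = 𝒢.unit x := by
  refine 𝒢.inv_eq_of_comp (by rw [𝒢.src_unit, 𝒢.tgt_unit]) ?_
  have := 𝒢.unit_comp (𝒢.unit x) (by rw [𝒢.src_unit])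
  refine Eq.trans (𝒢.comp_congr (by rw [𝒢.tgt_unit]) rfl _ _) (this.trans ?_)
  rw [𝒢.src_unit]

theorem inv_inv (g : G) : 𝒢.inv (𝒢.inv g) = g := by
  refine 𝒢.inv_eq_of_comp (𝒢.tgt_inv g).symm ?_
  rw [𝒢.comp_inv, 𝒢.src_inv]

end AlgGroupoid

/-- A Lie groupoid `G ⇉ M`.  The manifold `G₂`, with its smooth embedding `pr` into `G × G` whose
range is the set of composable pairs, is the manifold of composable pairs `G ×_M G`. -/
structure LieGroupoid {EG HG EM HM EG₂ HG₂ : Type*}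
    [NormedAddCommGroup EG] [NormedSpace ℝ EG] [TopologicalSpace HG]
    [NormedAddCommGroup EM] [NormedSpace ℝ EM] [TopologicalSpace HM]
    [NormedAddCommGroup EG₂] [NormedSpace ℝ EG₂] [TopologicalSpace HG₂]
    (IG : ModelWithCorners ℝ EG HG) (IM : ModelWithCorners ℝ EM HM) (IG₂ : ModelWithCorners ℝ EG₂ HG₂)
    (G M G₂ : Type*)
    [TopologicalSpace G] [ChartedSpace HG G] [IsManifold IG ∞ G]
    [TopologicalSpace M] [ChartedSpace HM M] [IsManifold IM ∞ M]
    [TopologicalSpace G₂] [ChartedSpace HG₂ G₂] [IsManifold IG₂ ∞ G₂] extends AlgGroupoid G M where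
  pr : G₂ → G × G
  composable : ∀ p, src (pr p).1 = tgt (pr p).2
  exists_pr : ∀ g h, src g = tgt h → ∃ p, pr p = (g, h)
  isSmoothEmbedding_pr : IsSmoothEmbedding IG₂ (IG.prod IG) ∞ pr
  isSubmersion_src : IsSubmersion IG IM ∞ src
  isSubmersion_tgt : IsSubmersion IG IM ∞ tgt
  contMDiff_unit : ContMDiff IM IG ∞ unit
  contMDiff_inv : ContMDiff IG IG ∞ inv
  contMDiff_mul : ContMDiff IG₂ IG ∞ fun p => comp (pr p).1 (pr p).2 (composable p)

namespace LieGroupoid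

variable {EG HG EM HM EG₂ HG₂ : Type*}
    [NormedAddCommGroup EG] [NormedSpace ℝ EG] [TopologicalSpace HG]
    [NormedAddCommGroup EM] [NormedSpace ℝ EM] [TopologicalSpace HM]
    [NormedAddCommGroup EG₂] [NormedSpace ℝ EG₂] [TopologicalSpace HG₂]
    {IG : ModelWithCorners ℝ EG HG} {IM : ModelWithCorners ℝ EM HM} {IG₂ : ModelWithCorners ℝ EG₂ HG₂}
    {G M G₂ : Type*}
    [TopologicalSpace G] [ChartedSpace HG G] [IsManifold IG ∞ G]
    [TopologicalSpace M] [ChartedSpace HM M] [IsManifold IM ∞ M]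
    [TopologicalSpace G₂] [ChartedSpace HG₂ G₂] [IsManifold IG₂ ∞ G₂]

/-- The multiplication map, defined on the manifold of composable pairs. -/
def mul (𝒢 : LieGroupoid IG IM IG₂ G M G₂) (p : G₂) : G :=
  𝒢.comp (𝒢.pr p).1 (𝒢.pr p).2 (𝒢.composable p)

theorem pr_injective (𝒢 : LieGroupoid IG IM IG₂ G M G₂) : Function.Injective 𝒢.pr :=
  𝒢.isSmoothEmbedding_pr.isEmbedding.injective

theorem contMDiff_comp (𝒢 : LieGroupoid IG IM IG₂ G M G₂)
    {EN HN : Type*} [NormedAddCommGroup EN] [NormedSpace ℝ EN] [TopologicalSpace HN]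
    {IN : ModelWithCorners ℝ EN HN} {N : Type*} [TopologicalSpace N] [ChartedSpace HN N]
    {a b : N → G} (ha : ContMDiff IN IG ∞ a) (hb : ContMDiff IN IG ∞ b)
    (w : ∀ n, 𝒢.src (a n) = 𝒢.tgt (b n)) :
    ContMDiff IN IG ∞ fun n => 𝒢.comp (a n) (b n) (w n) := by
  choose q hq using fun n => 𝒢.exists_pr (a n) (b n) (w n)
  have hpq : 𝒢.pr ∘ q = fun n => (a n, b n) := funext hq
  have h1 : ContMDiff IN (IG.prod IG) ∞ (𝒢.pr ∘ q) := by rw [hpq]; exact ha.prodMk hb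
  have h2 : Continuous q :=
    𝒢.isSmoothEmbedding_pr.isEmbedding.continuous_iff.2 h1.continuous
  have h3 : ContMDiff IN IG₂ ∞ q := by
    rw [ContMDiff.iff_comp_isImmersion 𝒢.isSmoothEmbedding_pr.isImmersion]
    exact ⟨h2, h1⟩
  have h4 := 𝒢.contMDiff_mul.comp h3
  refine h4.congr fun n => ?_
  have := hq n
  exact 𝒢.comp_congr (by rw [this]) (by rw [this]) _ _

end LieGroupoid

/-! ### VB-groupoids -/

theorem mk_cast {B F : Type*} {A : B → Type*} [∀ x, AddCommGroup (A x)] [∀ x, Module ℝ (A x)]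
    {x y : B} (h : x = y) (e : A x) :
    (⟨y, LinearEquiv.cast (R := ℝ) (M := A) h e⟩ : TotalSpace F A) = ⟨x, e⟩ := by
  subst h; rfl

theorem mk_zero_congr {B F : Type*} {A : B → Type*} [∀ x, AddCommGroup (A x)] {x y : B}
    (h : x = y) : (⟨x, 0⟩ : TotalSpace F A) = ⟨y, 0⟩ := by
  subst h; rfl

section VB

/-- A VB-groupoid `(V ⇉ E; G ⇉ M)`: Lie groupoids `V ⇉ E` (on the total spaces) and `G ⇉ M` such
that all structure maps of the former are morphisms of vector bundles over those of the latter.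
The bundle `V₂` over `G₂` is the vector bundle `V ×_E V` over `G ×_M G` of composable pairs. -/
structure VBGroupoid (EG EM EG₂ FV FE FV₂ : Type*)
    [NormedAddCommGroup EG] [NormedSpace ℝ EG] [NormedAddCommGroup EM] [NormedSpace ℝ EM]
    [NormedAddCommGroup EG₂] [NormedSpace ℝ EG₂] [NormedAddCommGroup FV] [NormedSpace ℝ FV]
    [NormedAddCommGroup FE] [NormedSpace ℝ FE] [NormedAddCommGroup FV₂] [NormedSpace ℝ FV₂]
    {G M G₂ : Type*}
    [TopologicalSpace G] [ChartedSpace EG G] [IsManifold 𝓘(ℝ, EG) ∞ G]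
    [TopologicalSpace M] [ChartedSpace EM M] [IsManifold 𝓘(ℝ, EM) ∞ M]
    [TopologicalSpace G₂] [ChartedSpace EG₂ G₂] [IsManifold 𝓘(ℝ, EG₂) ∞ G₂]
    (V : G → Type*) (E : M → Type*) (V₂ : G₂ → Type*)
    [TopologicalSpace (TotalSpace FV V)] [∀ g, TopologicalSpace (V g)]
    [∀ g, AddCommGroup (V g)] [∀ g, Module ℝ (V g)] [FiberBundle FV V]
    [VectorBundle ℝ FV V] [ContMDiffVectorBundle ∞ FV V 𝓘(ℝ, EG)]
    [TopologicalSpace (TotalSpace FE E)] [∀ x, TopologicalSpace (E x)]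
    [∀ x, AddCommGroup (E x)] [∀ x, Module ℝ (E x)] [FiberBundle FE E]
    [VectorBundle ℝ FE E] [ContMDiffVectorBundle ∞ FE E 𝓘(ℝ, EM)]
    [TopologicalSpace (TotalSpace FV₂ V₂)] [∀ p, TopologicalSpace (V₂ p)]
    [∀ p, AddCommGroup (V₂ p)] [∀ p, Module ℝ (V₂ p)] [FiberBundle FV₂ V₂]
    [VectorBundle ℝ FV₂ V₂] [ContMDiffVectorBundle ∞ FV₂ V₂ 𝓘(ℝ, EG₂)] where
  base : LieGroupoid 𝓘(ℝ, EG) 𝓘(ℝ, EM) 𝓘(ℝ, EG₂) G M G₂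
  total : LieGroupoid (𝓘(ℝ, EG).prod 𝓘(ℝ, FV)) (𝓘(ℝ, EM).prod 𝓘(ℝ, FE)) (𝓘(ℝ, EG₂).prod 𝓘(ℝ, FV₂))
    (TotalSpace FV V) (TotalSpace FE E) (TotalSpace FV₂ V₂)
  srcMap : ∀ g, V g →ₗ[ℝ] E (base.src g)
  tgtMap : ∀ g, V g →ₗ[ℝ] E (base.tgt g)
  unitMap : ∀ x, E x →ₗ[ℝ] V (base.unit x)
  invMap : ∀ g, V g →ₗ[ℝ] V (base.inv g)
  mulMap : ∀ p, V₂ p →ₗ[ℝ] V (base.mul p)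
  fstMap : ∀ p, V₂ p →ₗ[ℝ] V (base.pr p).1
  sndMap : ∀ p, V₂ p →ₗ[ℝ] V (base.pr p).2
  src_mk : ∀ g v, total.src ⟨g, v⟩ = ⟨base.src g, srcMap g v⟩
  tgt_mk : ∀ g v, total.tgt ⟨g, v⟩ = ⟨base.tgt g, tgtMap g v⟩
  unit_mk : ∀ x e, total.unit ⟨x, e⟩ = ⟨base.unit x, unitMap x e⟩
  inv_mk : ∀ g v, total.inv ⟨g, v⟩ = ⟨base.inv g, invMap g v⟩
  mul_mk : ∀ p w, total.mul ⟨p, w⟩ = ⟨base.mul p, mulMap p w⟩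
  pr_mk : ∀ p w, total.pr ⟨p, w⟩ = (⟨(base.pr p).1, fstMap p w⟩, ⟨(base.pr p).2, sndMap p w⟩)

namespace VBGroupoid

variable {EG EM EG₂ FV FE FV₂ : Type*}
    [NormedAddCommGroup EG] [NormedSpace ℝ EG] [NormedAddCommGroup EM] [NormedSpace ℝ EM]
    [NormedAddCommGroup EG₂] [NormedSpace ℝ EG₂] [NormedAddCommGroup FV] [NormedSpace ℝ FV]
    [NormedAddCommGroup FE] [NormedSpace ℝ FE] [NormedAddCommGroup FV₂] [NormedSpace ℝ FV₂]
    {G M G₂ : Type*}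
    [TopologicalSpace G] [ChartedSpace EG G] [IsManifold 𝓘(ℝ, EG) ∞ G]
    [TopologicalSpace M] [ChartedSpace EM M] [IsManifold 𝓘(ℝ, EM) ∞ M]
    [TopologicalSpace G₂] [ChartedSpace EG₂ G₂] [IsManifold 𝓘(ℝ, EG₂) ∞ G₂]
    {V : G → Type*} {E : M → Type*} {V₂ : G₂ → Type*}
    [TopologicalSpace (TotalSpace FV V)] [∀ g, TopologicalSpace (V g)]
    [∀ g, AddCommGroup (V g)] [∀ g, Module ℝ (V g)] [FiberBundle FV V]
    [VectorBundle ℝ FV V] [ContMDiffVectorBundle ∞ FV V 𝓘(ℝ, EG)]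
    [TopologicalSpace (TotalSpace FE E)] [∀ x, TopologicalSpace (E x)]
    [∀ x, AddCommGroup (E x)] [∀ x, Module ℝ (E x)] [FiberBundle FE E]
    [VectorBundle ℝ FE E] [ContMDiffVectorBundle ∞ FE E 𝓘(ℝ, EM)]
    [TopologicalSpace (TotalSpace FV₂ V₂)] [∀ p, TopologicalSpace (V₂ p)]
    [∀ p, AddCommGroup (V₂ p)] [∀ p, Module ℝ (V₂ p)] [FiberBundle FV₂ V₂]
    [VectorBundle ℝ FV₂ V₂] [ContMDiffVectorBundle ∞ FV₂ V₂ 𝓘(ℝ, EG₂)]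
    (𝒱 : VBGroupoid EG EM EG₂ FV FE FV₂ V E V₂)

/-- The fibre at `x` of the core `C = ker s̃ |_M`. -/
def core (x : M) : Submodule ℝ (V (𝒱.base.unit x)) :=
  LinearMap.ker (𝒱.srcMap (𝒱.base.unit x))

/-- The core-anchor map `∂ : C → E` at `x`, the restriction of `t̃` to the core. -/
def coreAnchor (x : M) : 𝒱.core x →ₗ[ℝ] E x :=
  (LinearEquiv.cast (R := ℝ) (M := E) (𝒱.base.tgt_unit x)).toLinearMap ∘ₗ
    𝒱.tgtMap (𝒱.base.unit x) ∘ₗ (𝒱.core x).subtype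

/-- The core-anchor map is (fibrewise) injective. -/
def InjectiveCoreAnchor : Prop :=
  ∀ x, Function.Injective (𝒱.coreAnchor x)

/-- The fibre at `x` of the subbundle `∂(C)` of `E`. -/
def coreImage (x : M) : Submodule ℝ (E x) :=
  LinearMap.range (𝒱.coreAnchor x)

/-- The fibre at `x` of the normal bundle `N₀ = E / C`. -/
abbrev N₀ (x : M) : Type _ := E x ⧸ 𝒱.coreImage x

/-- The fibre at `g` of the normal bundle `N₁ = V / (ker s̃ + ker t̃)`. -/
abbrev N₁ (g : G) : Type _ :=
  V g ⧸ (LinearMap.ker (𝒱.srcMap g) ⊔ LinearMap.ker (𝒱.tgtMap g))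

theorem total_mk_zero_src (g : G) :
    𝒱.total.src ⟨g, 0⟩ = (⟨𝒱.base.src g, 0⟩ : TotalSpace FE E) := by
  rw [𝒱.src_mk, map_zero]

theorem total_mk_zero_tgt (g : G) :
    𝒱.total.tgt ⟨g, 0⟩ = (⟨𝒱.base.tgt g, 0⟩ : TotalSpace FE E) := by
  rw [𝒱.tgt_mk, map_zero]

theorem proj_src (u : TotalSpace FV V) : (𝒱.total.src u).proj = 𝒱.base.src u.proj := by
  obtain ⟨g, v⟩ := u; rw [𝒱.src_mk]

theorem proj_tgt (u : TotalSpace FV V) : (𝒱.total.tgt u).proj = 𝒱.base.tgt u.proj := by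
  obtain ⟨g, v⟩ := u; rw [𝒱.tgt_mk]

theorem proj_comp (a b : TotalSpace FV V) (w : 𝒱.total.src a = 𝒱.total.tgt b) :
    (𝒱.total.comp a b w).proj = 𝒱.base.comp a.proj b.proj
      (by rw [← 𝒱.proj_src, ← 𝒱.proj_tgt, w]) := by
  obtain ⟨⟨p, q⟩, hq⟩ := 𝒱.total.exists_pr a b w
  have h1 : 𝒱.total.comp a b w = 𝒱.total.mul ⟨p, q⟩ :=
    𝒱.total.comp_congr (by rw [hq]) (by rw [hq]) _ _
  rw [h1, 𝒱.mul_mk]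
  rw [𝒱.pr_mk] at hq
  have ha : (𝒱.base.pr p).1 = a.proj := congrArg (fun z => z.1.proj) hq
  have hb : (𝒱.base.pr p).2 = b.proj := congrArg (fun z => z.2.proj) hq
  exact 𝒱.base.comp_congr ha hb _ _

/-- There is an element of `V` over the arrow `g` with source `a` and target `b`. -/
def Joins (g : G) (a b : TotalSpace FE E) : Prop :=
  ∃ u : TotalSpace FV V, u.proj = g ∧ 𝒱.total.src u = a ∧ 𝒱.total.tgt u = b

variable {𝒱}

theorem Joins.comp {g h : G} {a b c : TotalSpace FE E} (h₁ : 𝒱.Joins g a b) (h₂ : 𝒱.Joins h c a)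
    (w : 𝒱.base.src g = 𝒱.base.tgt h) : 𝒱.Joins (𝒱.base.comp g h w) c b := by
  obtain ⟨u, hu, hus, hut⟩ := h₁
  obtain ⟨v, hv, hvs, hvt⟩ := h₂
  refine ⟨𝒱.total.comp u v (hus.trans hvt.symm), ?_, ?_, ?_⟩
  · rw [𝒱.proj_comp]; exact 𝒱.base.comp_congr hu hv _ _
  · rw [𝒱.total.src_comp, hvs]
  · rw [𝒱.total.tgt_comp, hut]

theorem Joins.inv {g : G} {a b : TotalSpace FE E} (h : 𝒱.Joins g a b) :
    𝒱.Joins (𝒱.base.inv g) b a := by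
  obtain ⟨⟨g', v⟩, hu, hus, hut⟩ := h
  refine ⟨𝒱.total.inv ⟨g', v⟩, ?_, ?_, ?_⟩
  · rw [𝒱.inv_mk]; exact congrArg _ hu
  · rw [𝒱.total.src_inv, hut]
  · rw [𝒱.total.tgt_inv, hus]

variable (𝒱)

theorem joins_zero (g : G) : 𝒱.Joins g ⟨𝒱.base.src g, 0⟩ ⟨𝒱.base.tgt g, 0⟩ :=
  ⟨⟨g, 0⟩, rfl, 𝒱.total_mk_zero_src g, 𝒱.total_mk_zero_tgt g⟩

theorem joins_iff (g : G) (e : E (𝒱.base.src g)) (f : E (𝒱.base.tgt g)) :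
    𝒱.Joins g ⟨𝒱.base.src g, e⟩ ⟨𝒱.base.tgt g, f⟩ ↔
      ∃ v : V g, 𝒱.srcMap g v = e ∧ 𝒱.tgtMap g v = f := by
  constructor
  · rintro ⟨⟨g', v⟩, hu, hus, hut⟩
    obtain rfl : g' = g := hu
    rw [𝒱.src_mk] at hus
    rw [𝒱.tgt_mk] at hut
    exact ⟨v, TotalSpace.mk_injective _ hus, TotalSpace.mk_injective _ hut⟩
  · rintro ⟨v, rfl, rfl⟩
    exact ⟨⟨g, v⟩, rfl, 𝒱.src_mk g v, 𝒱.tgt_mk g v⟩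

theorem mk_coreAnchor (x : M) (c : 𝒱.core x) :
    (⟨x, 𝒱.coreAnchor x c⟩ : TotalSpace FE E) =
      ⟨𝒱.base.tgt (𝒱.base.unit x), 𝒱.tgtMap _ (c : V (𝒱.base.unit x))⟩ :=
  mk_cast (F := FE) (A := E) (𝒱.base.tgt_unit x) (𝒱.tgtMap _ (c : V (𝒱.base.unit x)))

theorem mem_coreImage_iff (x : M) (e : E x) :
    e ∈ 𝒱.coreImage x ↔ 𝒱.Joins (𝒱.base.unit x) ⟨x, 0⟩ ⟨x, e⟩ := by
  constructor
  · rintro ⟨c, rfl⟩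
    refine ⟨⟨𝒱.base.unit x, c⟩, rfl, ?_, ?_⟩
    · rw [𝒱.src_mk, LinearMap.mem_ker.1 c.2]
      exact mk_zero_congr (𝒱.base.src_unit x)
    · rw [𝒱.tgt_mk, mk_coreAnchor]
  · rintro ⟨⟨g', v⟩, hu, hus, hut⟩
    obtain rfl : g' = 𝒱.base.unit x := hu
    rw [𝒱.src_mk] at hus
    rw [𝒱.tgt_mk] at hut
    have hv : 𝒱.srcMap _ v = 0 :=
      TotalSpace.mk_injective _ (hus.trans (mk_zero_congr (𝒱.base.src_unit x)).symm)
    refine ⟨⟨v, LinearMap.mem_ker.2 hv⟩, TotalSpace.mk_injective (F := FE) x ?_⟩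
    rw [mk_coreAnchor, hut]

theorem joins_congr {g g' : G} (h : g = g') {a a' b b' : TotalSpace FE E} (ha : a = a')
    (hb : b = b') : 𝒱.Joins g a b ↔ 𝒱.Joins g' a' b' := by
  subst h ha hb; rfl

theorem mem_coreImage_src_iff (g : G) (e : E (𝒱.base.src g)) :
    e ∈ 𝒱.coreImage (𝒱.base.src g) ↔ ∃ v : V g, 𝒱.tgtMap g v = 0 ∧ 𝒱.srcMap g v = e := by
  have h0 : (∃ v : V g, 𝒱.tgtMap g v = 0 ∧ 𝒱.srcMap g v = e) ↔
      𝒱.Joins g ⟨𝒱.base.src g, e⟩ ⟨𝒱.base.tgt g, 0⟩ := by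
    rw [joins_iff]; simp only [and_comm]
  rw [h0, mem_coreImage_iff]
  constructor
  · intro h
    have h1 := Joins.comp (𝒱.joins_zero g) h.inv
      (by rw [𝒱.base.tgt_inv, 𝒱.base.src_unit])
    refine (𝒱.joins_congr ?_ rfl rfl).1 h1
    rw [𝒱.base.comp_congr rfl (𝒱.base.inv_unit _) _ (𝒱.base.tgt_unit _).symm, 𝒱.base.comp_unit]
  · intro h
    have h1 := Joins.comp (𝒱.joins_zero g).inv h (𝒱.base.src_inv g)
    have h2 := h1.inv
    refine (𝒱.joins_congr ?_ rfl rfl).1 h2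
    rw [𝒱.base.inv_comp, 𝒱.base.inv_unit]

theorem mem_coreImage_tgt_iff (g : G) (e : E (𝒱.base.tgt g)) :
    e ∈ 𝒱.coreImage (𝒱.base.tgt g) ↔ ∃ v : V g, 𝒱.srcMap g v = 0 ∧ 𝒱.tgtMap g v = e := by
  rw [← joins_iff, mem_coreImage_iff]
  constructor
  · intro h
    have h1 := h.comp (𝒱.joins_zero g) (𝒱.base.src_unit _)
    refine (𝒱.joins_congr ?_ rfl rfl).1 h1
    rw [𝒱.base.unit_comp]
  · intro h
    have h1 := h.comp (𝒱.joins_zero g).inv (𝒱.base.tgt_inv g).symm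
    refine (𝒱.joins_congr ?_ rfl rfl).1 h1
    rw [𝒱.base.comp_inv]

theorem exists_lift (p : G₂) (v : V (𝒱.base.pr p).1) (v' : V (𝒱.base.pr p).2)
    (h : 𝒱.total.src ⟨_, v⟩ = 𝒱.total.tgt ⟨_, v'⟩) :
    ∃ w : V₂ p, 𝒱.fstMap p w = v ∧ 𝒱.sndMap p w = v' := by
  obtain ⟨⟨p', w⟩, hq⟩ := 𝒱.total.exists_pr _ _ h
  rw [𝒱.pr_mk] at hq
  have h1 : (𝒱.base.pr p').1 = (𝒱.base.pr p).1 := congrArg (fun z => z.1.proj) hq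
  have h2 : (𝒱.base.pr p').2 = (𝒱.base.pr p).2 := congrArg (fun z => z.2.proj) hq
  obtain rfl : p' = p := 𝒱.base.pr_injective (Prod.ext h1 h2)
  exact ⟨w, TotalSpace.mk_injective _ (congrArg Prod.fst hq),
    TotalSpace.mk_injective _ (congrArg Prod.snd hq)⟩

theorem srcMap_unit_surjective (x : M) : Function.Surjective (𝒱.srcMap (𝒱.base.unit x)) := by
  intro e
  obtain ⟨e', he'⟩ : ∃ e' : E x, (⟨x, e'⟩ : TotalSpace FE E) = ⟨_, e⟩ :=
    ⟨LinearEquiv.cast (R := ℝ) (M := E) (𝒱.base.src_unit x) e, mk_cast _ _⟩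
  refine ⟨𝒱.unitMap x e', TotalSpace.mk_injective (F := FE) _ ?_⟩
  rw [← 𝒱.src_mk, ← 𝒱.unit_mk, 𝒱.total.src_unit, he']

section Surjective

variable [FiniteDimensional ℝ FV] [FiniteDimensional ℝ FE]

theorem srcMap_surjective (g : G) : Function.Surjective (𝒱.srcMap g) := by
  have finV : ∀ k : G, FiniteDimensional ℝ (V k) := fun k =>
    Module.Finite.equiv
      ((trivializationAt FV V k).linearEquivAt ℝ k (mem_baseSet_trivializationAt FV V k)).symm
  have finE : ∀ x : M, FiniteDimensional ℝ (E x) := fun x =>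
    Module.Finite.equiv
      ((trivializationAt FE E x).linearEquivAt ℝ x (mem_baseSet_trivializationAt FE E x)).symm
  have dimV : ∀ k : G, Module.finrank ℝ (V k) = Module.finrank ℝ FV := fun k =>
    ((trivializationAt FV V k).linearEquivAt ℝ k
      (mem_baseSet_trivializationAt FV V k)).finrank_eq
  have dimE : ∀ x : M, Module.finrank ℝ (E x) = Module.finrank ℝ FE := fun x =>
    ((trivializationAt FE E x).linearEquivAt ℝ x
      (mem_baseSet_trivializationAt FE E x)).finrank_eq
  obtain ⟨p, hp⟩ := 𝒱.base.exists_pr g (𝒱.base.inv g) (𝒱.base.tgt_inv g).symm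
  have hmul : 𝒱.base.mul p = 𝒱.base.unit (𝒱.base.tgt g) := by
    rw [← 𝒱.base.comp_inv g (𝒱.base.tgt_inv g).symm]
    exact 𝒱.base.comp_congr (by rw [hp]) (by rw [hp]) _ _
  have hsurj : Function.Surjective (𝒱.srcMap (𝒱.base.mul p)) := by
    rw [hmul]; exact 𝒱.srcMap_unit_surjective _
  obtain rfl : (𝒱.base.pr p).1 = g := congrArg Prod.fst hp
  -- right translation by the zero element over the inverse
  have hlift : ∀ v : LinearMap.ker (𝒱.srcMap (𝒱.base.pr p).1), ∃ w : V₂ p,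
      𝒱.fstMap p w = v ∧ 𝒱.sndMap p w = 0 := by
    intro v
    refine 𝒱.exists_lift p v 0 ?_
    rw [𝒱.src_mk, 𝒱.tgt_mk, LinearMap.mem_ker.1 v.2, map_zero]
    exact mk_zero_congr (𝒱.base.composable p)
  have hinj : ∀ w w' : V₂ p, 𝒱.fstMap p w = 𝒱.fstMap p w' → 𝒱.sndMap p w = 𝒱.sndMap p w' →
      w = w' := by
    intro w w' h1 h2
    refine TotalSpace.mk_injective (F := FV₂) p (𝒱.total.pr_injective ?_)
    rw [𝒱.pr_mk, 𝒱.pr_mk, h1, h2]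
  choose L hL1 hL2 using hlift
  let Φ : LinearMap.ker (𝒱.srcMap (𝒱.base.pr p).1) →ₗ[ℝ]
      LinearMap.ker (𝒱.srcMap (𝒱.base.mul p)) :=
    { toFun := fun v => ⟨𝒱.mulMap p (L v), by
        refine LinearMap.mem_ker.2 (TotalSpace.mk_injective (F := FE) _ ?_)
        rw [← 𝒱.src_mk, ← 𝒱.mul_mk, LieGroupoid.mul, 𝒱.total.src_comp]
        rw [𝒱.pr_mk, hL2]
        dsimp only
        rw [𝒱.src_mk, map_zero]
        exact mk_zero_congr (𝒱.base.src_comp _ _ _).symm⟩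
      map_add' := fun v v' => by
        refine Subtype.ext ?_
        have : L (v + v') = L v + L v' :=
          hinj _ _ (by rw [hL1, map_add, hL1, hL1]; rfl) (by rw [hL2, map_add, hL2, hL2, add_zero])
        simp [this]
      map_smul' := fun r v => by
        refine Subtype.ext ?_
        have : L (r • v) = r • L v :=
          hinj _ _ (by rw [hL1, map_smul, hL1]; rfl) (by rw [hL2, map_smul, hL2, smul_zero])
        simp [this] }
  have hΦ : Function.Injective Φ := by
    intro v v' h
    have h1 : 𝒱.mulMap p (L v) = 𝒱.mulMap p (L v') := congrArg Subtype.val h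
    have h2 : 𝒱.total.mul ⟨p, L v⟩ = 𝒱.total.mul ⟨p, L v'⟩ := by
      rw [𝒱.mul_mk, 𝒱.mul_mk, h1]
    have hs : (𝒱.total.pr ⟨p, L v⟩).2 = (𝒱.total.pr ⟨p, L v'⟩).2 := by
      rw [𝒱.pr_mk, 𝒱.pr_mk, hL2, hL2]
    have h3 : (𝒱.total.pr ⟨p, L v⟩).1 = (𝒱.total.pr ⟨p, L v'⟩).1 := by
      refine 𝒱.total.comp_right_cancel (h := (𝒱.total.pr ⟨p, L v'⟩).2)
        (by rw [← hs]; exact 𝒱.total.composable _) (𝒱.total.composable _) (Eq.trans ?_ h2)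
      exact 𝒱.total.comp_congr rfl hs.symm _ _
    rw [𝒱.pr_mk, 𝒱.pr_mk, hL1, hL1] at h3
    exact Subtype.ext (TotalSpace.mk_injective _ h3)
  have := finV (𝒱.base.pr p).1
  have := finV (𝒱.base.mul p)
  have := finE (𝒱.base.src (𝒱.base.pr p).1)
  have := finE (𝒱.base.src (𝒱.base.mul p))
  have hle := LinearMap.finrank_le_finrank_of_injective hΦ
  have r1 := LinearMap.finrank_range_add_finrank_ker (𝒱.srcMap (𝒱.base.pr p).1)
  have r2 := LinearMap.finrank_range_add_finrank_ker (𝒱.srcMap (𝒱.base.mul p))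
  rw [LinearMap.range_eq_top.2 hsurj, finrank_top] at r2
  have r3 := Submodule.finrank_le (LinearMap.range (𝒱.srcMap (𝒱.base.pr p).1))
  rw [dimV, dimE] at r2
  rw [dimV] at r1
  rw [dimE] at r3
  rw [← LinearMap.range_eq_top]
  refine Submodule.eq_top_of_finrank_eq ?_
  rw [dimE]
  omega

theorem tgtMap_surjective (g : G) : Function.Surjective (𝒱.tgtMap g) := by
  intro e
  have hx : 𝒱.base.tgt g = 𝒱.base.src (𝒱.base.inv g) := (𝒱.base.src_inv g).symm
  obtain ⟨v, hv⟩ := 𝒱.srcMap_surjective (𝒱.base.inv g) (LinearEquiv.cast (R := ℝ) (M := E) hx e)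
  have h1 : 𝒱.total.tgt (𝒱.total.inv ⟨_, v⟩) = (⟨_, e⟩ : TotalSpace FE E) := by
    rw [𝒱.total.tgt_inv, 𝒱.src_mk, hv, mk_cast]
  have h2 : (𝒱.total.inv ⟨_, v⟩ : TotalSpace FV V).proj = g := by
    rw [𝒱.inv_mk]; exact 𝒱.base.inv_inv g
  generalize 𝒱.total.inv ⟨_, v⟩ = u at h1 h2
  obtain ⟨g', v'⟩ := u
  obtain rfl : g' = g := h2
  rw [𝒱.tgt_mk] at h1
  exact ⟨v', TotalSpace.mk_injective _ h1⟩

end Surjective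

theorem ker_sup_ker_le_src (g : G) :
    LinearMap.ker (𝒱.srcMap g) ⊔ LinearMap.ker (𝒱.tgtMap g) ≤
      (𝒱.coreImage (𝒱.base.src g)).comap (𝒱.srcMap g) := by
  refine sup_le (fun v hv => ?_) (fun v hv => ?_)
  · rw [Submodule.mem_comap, LinearMap.mem_ker.1 hv]; exact zero_mem _
  · exact (𝒱.mem_coreImage_src_iff g _).2 ⟨v, hv, rfl⟩

theorem ker_sup_ker_le_tgt (g : G) :
    LinearMap.ker (𝒱.srcMap g) ⊔ LinearMap.ker (𝒱.tgtMap g) ≤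
      (𝒱.coreImage (𝒱.base.tgt g)).comap (𝒱.tgtMap g) := by
  refine sup_le (fun v hv => ?_) (fun v hv => ?_)
  · exact (𝒱.mem_coreImage_tgt_iff g _).2 ⟨v, hv, rfl⟩
  · rw [Submodule.mem_comap, LinearMap.mem_ker.1 hv]; exact zero_mem _

/-- The map `N₁ → N₀` over `s` induced by `s̃`, on the fibre at `g`. -/
def srcBar (g : G) : 𝒱.N₁ g →ₗ[ℝ] 𝒱.N₀ (𝒱.base.src g) :=
  Submodule.mapQ _ _ (𝒱.srcMap g) (𝒱.ker_sup_ker_le_src g)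

/-- The map `N₁ → N₀` over `t` induced by `t̃`, on the fibre at `g`. -/
def tgtBar (g : G) : 𝒱.N₁ g →ₗ[ℝ] 𝒱.N₀ (𝒱.base.tgt g) :=
  Submodule.mapQ _ _ (𝒱.tgtMap g) (𝒱.ker_sup_ker_le_tgt g)

variable [FiniteDimensional ℝ FV] [FiniteDimensional ℝ FE]

theorem srcBar_bijective (g : G) : Function.Bijective (𝒱.srcBar g) := by
  constructor
  · rw [← LinearMap.ker_eq_bot, LinearMap.ker_eq_bot']
    intro q hq
    obtain ⟨v, rfl⟩ := Submodule.Quotient.mk_surjective _ q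
    rw [srcBar, Submodule.mapQ_apply, Submodule.Quotient.mk_eq_zero,
      𝒱.mem_coreImage_src_iff] at hq
    obtain ⟨v', h1, h2⟩ := hq
    rw [Submodule.Quotient.mk_eq_zero, ← sub_add_cancel v v']
    exact Submodule.add_mem_sup (LinearMap.mem_ker.2 (by rw [map_sub, h2, sub_self]))
      (LinearMap.mem_ker.2 h1)
  · intro q
    obtain ⟨e, rfl⟩ := Submodule.Quotient.mk_surjective _ q
    obtain ⟨v, rfl⟩ := 𝒱.srcMap_surjective g e
    exact ⟨Submodule.Quotient.mk v, Submodule.mapQ_apply ..⟩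

theorem tgtBar_bijective (g : G) : Function.Bijective (𝒱.tgtBar g) := by
  constructor
  · rw [← LinearMap.ker_eq_bot, LinearMap.ker_eq_bot']
    intro q hq
    obtain ⟨v, rfl⟩ := Submodule.Quotient.mk_surjective _ q
    rw [tgtBar, Submodule.mapQ_apply, Submodule.Quotient.mk_eq_zero,
      𝒱.mem_coreImage_tgt_iff] at hq
    obtain ⟨v', h1, h2⟩ := hq
    rw [Submodule.Quotient.mk_eq_zero, ← add_sub_cancel v' v]
    exact Submodule.add_mem_sup (LinearMap.mem_ker.2 h1)
      (LinearMap.mem_ker.2 (by rw [map_sub, h2, sub_self]))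
  · intro q
    obtain ⟨e, rfl⟩ := Submodule.Quotient.mk_surjective _ q
    obtain ⟨v, rfl⟩ := 𝒱.tgtMap_surjective g e
    exact ⟨Submodule.Quotient.mk v, Submodule.mapQ_apply ..⟩

/-- The pullback `s̃^* λ` of a section `λ` of `N₀` along the fibrewise invertible map
`s̃ : N₁ → N₀`. -/
noncomputable def srcPullback (l : ∀ x, 𝒱.N₀ x) (g : G) : 𝒱.N₁ g :=
  (LinearEquiv.ofBijective (𝒱.srcBar g) (𝒱.srcBar_bijective g)).symm (l (𝒱.base.src g))

/-- The pullback `t̃^* λ` of a section `λ` of `N₀` along the fibrewise invertible map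
`t̃ : N₁ → N₀`. -/
noncomputable def tgtPullback (l : ∀ x, 𝒱.N₀ x) (g : G) : 𝒱.N₁ g :=
  (LinearEquiv.ofBijective (𝒱.tgtBar g) (𝒱.tgtBar_bijective g)).symm (l (𝒱.base.tgt g))

end VBGroupoid

end VB

/-! ### Lie algebroids and their morphisms -/

section LieAlgebroid

/-- The derivative of a smooth function `f` in the direction of a tangent vector `v` at `x`. -/
noncomputable def dirDeriv {EM HM : Type*} [NormedAddCommGroup EM] [NormedSpace ℝ EM]
    [TopologicalSpace HM] {I : ModelWithCorners ℝ EM HM} {M : Type*} [TopologicalSpace M]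
    [ChartedSpace HM M] (f : C^∞⟮I, M; 𝓘(ℝ, ℝ), ℝ⟯) (x : M) (v : TangentSpace I x) : ℝ :=
  mfderiv I 𝓘(ℝ, ℝ) f x v

/-- The product of a smooth function and a smooth section. -/
noncomputable def funSMul {EM HM F : Type*} [NormedAddCommGroup EM] [NormedSpace ℝ EM]
    [TopologicalSpace HM] {I : ModelWithCorners ℝ EM HM} {M : Type*} [TopologicalSpace M]
    [ChartedSpace HM M] [NormedAddCommGroup F] [NormedSpace ℝ F] {A : M → Type*}
    [TopologicalSpace (TotalSpace F A)] [∀ x, TopologicalSpace (A x)]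
    [∀ x, AddCommGroup (A x)] [∀ x, Module ℝ (A x)] [FiberBundle F A] [VectorBundle ℝ F A]
    (f : C^∞⟮I, M; 𝓘(ℝ, ℝ), ℝ⟯) (X : Cₛ^∞⟮I; F, A⟯) : Cₛ^∞⟮I; F, A⟯ :=
  ⟨fun x => f x • X x, f.contMDiff.smul_section X.contMDiff⟩

/-- A Lie algebroid structure on the vector bundle `A` over `M`. -/
structure LieAlgebroid {EM HM : Type*} [NormedAddCommGroup EM] [NormedSpace ℝ EM]
    [TopologicalSpace HM] (I : ModelWithCorners ℝ EM HM) {M : Type*} [TopologicalSpace M]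
    [ChartedSpace HM M] [IsManifold I ∞ M] (F : Type*) [NormedAddCommGroup F] [NormedSpace ℝ F]
    (A : M → Type*) [TopologicalSpace (TotalSpace F A)] [∀ x, TopologicalSpace (A x)]
    [∀ x, AddCommGroup (A x)] [∀ x, Module ℝ (A x)] [FiberBundle F A] [VectorBundle ℝ F A]
    [ContMDiffVectorBundle ∞ F A I] where
  bracket : Cₛ^∞⟮I; F, A⟯ →ₗ[ℝ] Cₛ^∞⟮I; F, A⟯ →ₗ[ℝ] Cₛ^∞⟮I; F, A⟯
  anchor : ∀ x, A x →ₗ[ℝ] TangentSpace I x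
  contMDiff_anchor : ContMDiff (I.prod 𝓘(ℝ, F)) I.tangent ∞
    fun v : TotalSpace F A => (⟨v.1, anchor v.1 v.2⟩ : TangentBundle I M)
  bracket_self : ∀ X, bracket X X = 0
  jacobi : ∀ X Y Z, bracket X (bracket Y Z) = bracket (bracket X Y) Z + bracket Y (bracket X Z)
  leibniz : ∀ (X Y : Cₛ^∞⟮I; F, A⟯) (f : C^∞⟮I, M; 𝓘(ℝ, ℝ), ℝ⟯) (x : M),
    bracket X (funSMul f Y) x = f x • bracket X Y x + dirDeriv f x (anchor x (X x)) • Y x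

namespace LieAlgebroid

section

variable {EM HM : Type*} [NormedAddCommGroup EM] [NormedSpace ℝ EM]
    [TopologicalSpace HM] {I : ModelWithCorners ℝ EM HM} {M : Type*} [TopologicalSpace M]
    [ChartedSpace HM M] [IsManifold I ∞ M] {F : Type*} [NormedAddCommGroup F] [NormedSpace ℝ F]
    {A : M → Type*} [TopologicalSpace (TotalSpace F A)] [∀ x, TopologicalSpace (A x)]
    [∀ x, AddCommGroup (A x)] [∀ x, Module ℝ (A x)] [FiberBundle F A] [VectorBundle ℝ F A]
    [ContMDiffVectorBundle ∞ F A I]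

/-- The Lie algebra `Γ(A)` of smooth sections of a Lie algebroid `A`. -/
def Sections (_𝒜 : LieAlgebroid I F A) : Type _ := Cₛ^∞⟮I; F, A⟯

noncomputable instance (𝒜 : LieAlgebroid I F A) : DFunLike 𝒜.Sections M A :=
  inferInstanceAs (DFunLike Cₛ^∞⟮I; F, A⟯ M A)

noncomputable instance (𝒜 : LieAlgebroid I F A) : AddCommGroup 𝒜.Sections :=
  inferInstanceAs (AddCommGroup Cₛ^∞⟮I; F, A⟯)

noncomputable instance (𝒜 : LieAlgebroid I F A) : Module ℝ 𝒜.Sections :=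
  inferInstanceAs (Module ℝ Cₛ^∞⟮I; F, A⟯)

noncomputable instance (𝒜 : LieAlgebroid I F A) : LieRing 𝒜.Sections where
  bracket X Y := 𝒜.bracket X Y
  add_lie X Y Z := LinearMap.congr_fun (𝒜.bracket.map_add X Y) Z
  lie_add X Y Z := (𝒜.bracket X).map_add Y Z
  lie_self X := 𝒜.bracket_self X
  leibniz_lie X Y Z := 𝒜.jacobi X Y Z

noncomputable instance (𝒜 : LieAlgebroid I F A) : LieAlgebra ℝ 𝒜.Sections where
  lie_smul r X Y := (𝒜.bracket X).map_smul r Y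

theorem Sections.add_apply {𝒜 : LieAlgebroid I F A} (X Y : 𝒜.Sections) (x : M) :
    (X + Y) x = X x + Y x := rfl

theorem Sections.sub_apply {𝒜 : LieAlgebroid I F A} (X Y : 𝒜.Sections) (x : M) :
    (X - Y) x = X x - Y x := rfl

theorem Sections.smul_apply {𝒜 : LieAlgebroid I F A} (r : ℝ) (X : 𝒜.Sections) (x : M) :
    (r • X) x = r • X x := rfl

theorem Sections.zero_apply {𝒜 : LieAlgebroid I F A} (x : M) : (0 : 𝒜.Sections) x = 0 := rfl

theorem Sections.contMDiff {𝒜 : LieAlgebroid I F A} (X : 𝒜.Sections) :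
    ContMDiff I (I.prod 𝓘(ℝ, F)) ∞ fun x => (⟨x, X x⟩ : TotalSpace F A) :=
  ContMDiffSection.contMDiff (X : Cₛ^∞⟮I; F, A⟯)

end

/-- `Φ : A → B` is a morphism of Lie algebroids over `φ : N → M`.  The condition on brackets is
expressed through decompositions `Φ ∘ X = ∑ i, f i • (X' i ∘ φ)` of the images of sections of `A`
into pullbacks of sections of `B`. -/
structure IsMorphism {EN HN : Type*} [NormedAddCommGroup EN] [NormedSpace ℝ EN]
    [TopologicalSpace HN] {J : ModelWithCorners ℝ EN HN} {N : Type*} [TopologicalSpace N]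
    [ChartedSpace HN N] [IsManifold J ∞ N] {K : Type*} [NormedAddCommGroup K] [NormedSpace ℝ K]
    {A : N → Type*} [TopologicalSpace (TotalSpace K A)] [∀ x, TopologicalSpace (A x)]
    [∀ x, AddCommGroup (A x)] [∀ x, Module ℝ (A x)] [FiberBundle K A] [VectorBundle ℝ K A]
    [ContMDiffVectorBundle ∞ K A J]
    {EM HM : Type*} [NormedAddCommGroup EM] [NormedSpace ℝ EM]
    [TopologicalSpace HM] {I : ModelWithCorners ℝ EM HM} {M : Type*} [TopologicalSpace M]
    [ChartedSpace HM M] [IsManifold I ∞ M] {F : Type*} [NormedAddCommGroup F] [NormedSpace ℝ F]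
    {B : M → Type*} [TopologicalSpace (TotalSpace F B)] [∀ x, TopologicalSpace (B x)]
    [∀ x, AddCommGroup (B x)] [∀ x, Module ℝ (B x)] [FiberBundle F B] [VectorBundle ℝ F B]
    [ContMDiffVectorBundle ∞ F B I]
    (𝒜 : LieAlgebroid J K A) (ℬ : LieAlgebroid I F B) (φ : N → M)
    (Φ : ∀ n, A n →ₗ[ℝ] B (φ n)) : Prop where
  contMDiff_base : ContMDiff J I ∞ φ
  contMDiff : ContMDiff (J.prod 𝓘(ℝ, K)) (I.prod 𝓘(ℝ, F)) ∞
    fun v : TotalSpace K A => (⟨φ v.1, Φ v.1 v.2⟩ : TotalSpace F B)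
  anchor : ∀ n (v : A n), ℬ.anchor (φ n) (Φ n v) = mfderiv J I φ n (𝒜.anchor n v)
  bracket : ∀ (p q : ℕ) (X Y : 𝒜.Sections)
    (f : Fin p → C^∞⟮J, N; 𝓘(ℝ, ℝ), ℝ⟯) (g : Fin q → C^∞⟮J, N; 𝓘(ℝ, ℝ), ℝ⟯)
    (X' : Fin p → ℬ.Sections) (Y' : Fin q → ℬ.Sections),
    (∀ n, Φ n (X n) = ∑ i, f i n • X' i (φ n)) →
    (∀ n, Φ n (Y n) = ∑ j, g j n • Y' j (φ n)) →
    ∀ n, Φ n (⁅X, Y⁆ n) = ∑ i, ∑ j, (f i n * g j n) • ⁅X' i, Y' j⁆ (φ n)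
      + ∑ j, dirDeriv (g j) n (𝒜.anchor n (X n)) • Y' j (φ n)
      - ∑ i, dirDeriv (f i) n (𝒜.anchor n (Y n)) • X' i (φ n)

end LieAlgebroid

end LieAlgebroid

/-! ### LA-groupoids -/

section LA

/-- An LA-groupoid: a VB-groupoid `(V ⇉ E; G ⇉ M)` with Lie algebroid structures on `V` and `E`
such that all structure maps are Lie algebroid morphisms.  The Lie algebroid `algV₂` on the bundle
of composable pairs is the fibre product Lie algebroid `V ×_E V`: it is determined by the condition
that both projections to `V` are Lie algebroid morphisms. -/
structure LAGroupoid (EG EM EG₂ FV FE FV₂ : Type*)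
    [NormedAddCommGroup EG] [NormedSpace ℝ EG] [NormedAddCommGroup EM] [NormedSpace ℝ EM]
    [NormedAddCommGroup EG₂] [NormedSpace ℝ EG₂] [NormedAddCommGroup FV] [NormedSpace ℝ FV]
    [NormedAddCommGroup FE] [NormedSpace ℝ FE] [NormedAddCommGroup FV₂] [NormedSpace ℝ FV₂]
    {G M G₂ : Type*}
    [TopologicalSpace G] [ChartedSpace EG G] [IsManifold 𝓘(ℝ, EG) ∞ G]
    [TopologicalSpace M] [ChartedSpace EM M] [IsManifold 𝓘(ℝ, EM) ∞ M]
    [TopologicalSpace G₂] [ChartedSpace EG₂ G₂] [IsManifold 𝓘(ℝ, EG₂) ∞ G₂]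
    (V : G → Type*) (E : M → Type*) (V₂ : G₂ → Type*)
    [TopologicalSpace (TotalSpace FV V)] [∀ g, TopologicalSpace (V g)]
    [∀ g, AddCommGroup (V g)] [∀ g, Module ℝ (V g)] [FiberBundle FV V]
    [VectorBundle ℝ FV V] [ContMDiffVectorBundle ∞ FV V 𝓘(ℝ, EG)]
    [TopologicalSpace (TotalSpace FE E)] [∀ x, TopologicalSpace (E x)]
    [∀ x, AddCommGroup (E x)] [∀ x, Module ℝ (E x)] [FiberBundle FE E]
    [VectorBundle ℝ FE E] [ContMDiffVectorBundle ∞ FE E 𝓘(ℝ, EM)]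
    [TopologicalSpace (TotalSpace FV₂ V₂)] [∀ p, TopologicalSpace (V₂ p)]
    [∀ p, AddCommGroup (V₂ p)] [∀ p, Module ℝ (V₂ p)] [FiberBundle FV₂ V₂]
    [VectorBundle ℝ FV₂ V₂] [ContMDiffVectorBundle ∞ FV₂ V₂ 𝓘(ℝ, EG₂)]
    extends VBGroupoid EG EM EG₂ FV FE FV₂ V E V₂ where
  algV : LieAlgebroid 𝓘(ℝ, EG) FV V
  algE : LieAlgebroid 𝓘(ℝ, EM) FE E
  algV₂ : LieAlgebroid 𝓘(ℝ, EG₂) FV₂ V₂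
  isMorphism_fst : algV₂.IsMorphism algV (fun p => (base.pr p).1) fstMap
  isMorphism_snd : algV₂.IsMorphism algV (fun p => (base.pr p).2) sndMap
  isMorphism_src : algV.IsMorphism algE base.src srcMap
  isMorphism_tgt : algV.IsMorphism algE base.tgt tgtMap
  isMorphism_unit : algE.IsMorphism algV base.unit unitMap
  isMorphism_inv : algV.IsMorphism algV base.inv invMap
  isMorphism_mul : algV₂.IsMorphism algV base.mul mulMap


namespace LAGroupoid

variable {EG EM EG₂ FV FE FV₂ : Type*}
    [NormedAddCommGroup EG] [NormedSpace ℝ EG] [NormedAddCommGroup EM] [NormedSpace ℝ EM]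
    [NormedAddCommGroup EG₂] [NormedSpace ℝ EG₂] [NormedAddCommGroup FV] [NormedSpace ℝ FV]
    [NormedAddCommGroup FE] [NormedSpace ℝ FE] [NormedAddCommGroup FV₂] [NormedSpace ℝ FV₂]
    {G M G₂ : Type*}
    [TopologicalSpace G] [ChartedSpace EG G] [IsManifold 𝓘(ℝ, EG) ∞ G]
    [TopologicalSpace M] [ChartedSpace EM M] [IsManifold 𝓘(ℝ, EM) ∞ M]
    [TopologicalSpace G₂] [ChartedSpace EG₂ G₂] [IsManifold 𝓘(ℝ, EG₂) ∞ G₂]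
    {V : G → Type*} {E : M → Type*} {V₂ : G₂ → Type*}
    [TopologicalSpace (TotalSpace FV V)] [∀ g, TopologicalSpace (V g)]
    [∀ g, AddCommGroup (V g)] [∀ g, Module ℝ (V g)] [FiberBundle FV V]
    [VectorBundle ℝ FV V] [ContMDiffVectorBundle ∞ FV V 𝓘(ℝ, EG)]
    [TopologicalSpace (TotalSpace FE E)] [∀ x, TopologicalSpace (E x)]
    [∀ x, AddCommGroup (E x)] [∀ x, Module ℝ (E x)] [FiberBundle FE E]
    [VectorBundle ℝ FE E] [ContMDiffVectorBundle ∞ FE E 𝓘(ℝ, EM)]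
    [TopologicalSpace (TotalSpace FV₂ V₂)] [∀ p, TopologicalSpace (V₂ p)]
    [∀ p, AddCommGroup (V₂ p)] [∀ p, Module ℝ (V₂ p)] [FiberBundle FV₂ V₂]
    [VectorBundle ℝ FV₂ V₂] [ContMDiffVectorBundle ∞ FV₂ V₂ 𝓘(ℝ, EG₂)]
    (𝒱 : LAGroupoid EG EM EG₂ FV FE FV₂ V E V₂)

/-- The condition that a family `c` of elements of the fibres of the core is a smooth section of the
core. -/
def IsSmoothCoreSection (c : ∀ x, 𝒱.core x) : Prop :=
  ContMDiff 𝓘(ℝ, EM) (𝓘(ℝ, EG).prod 𝓘(ℝ, FV)) ∞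
    fun x => (⟨𝒱.base.unit x, c x⟩ : TotalSpace FV V)

/-- Smoothness of linear combinations of maps into the total space of a vector bundle. -/
theorem contMDiff_lin_comb {k : M → G}
    {a b : ∀ x, V (k x)} (r t : ℝ)
    (ha : ContMDiff 𝓘(ℝ, EM) (𝓘(ℝ, EG).prod 𝓘(ℝ, FV)) ∞ fun x => (⟨k x, a x⟩ : TotalSpace FV V))
    (hb : ContMDiff 𝓘(ℝ, EM) (𝓘(ℝ, EG).prod 𝓘(ℝ, FV)) ∞ fun x => (⟨k x, b x⟩ : TotalSpace FV V)) :
    ContMDiff 𝓘(ℝ, EM) (𝓘(ℝ, EG).prod 𝓘(ℝ, FV)) ∞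
      fun x => (⟨k x, r • a x + t • b x⟩ : TotalSpace FV V) := by
  intro x₀
  have ha := contMDiffAt_totalSpace.1 (ha x₀)
  have hb := contMDiffAt_totalSpace.1 (hb x₀)
  refine contMDiffAt_totalSpace.2 ⟨ha.1, ?_⟩
  have hmem : ∀ᶠ x in 𝓝 x₀, k x ∈ (trivializationAt FV V (k x₀)).baseSet :=
    ha.1.continuousAt.eventually
      ((trivializationAt FV V (k x₀)).open_baseSet.mem_nhds (mem_baseSet_trivializationAt FV V _))
  have h1 := (contMDiffAt_const (I := 𝓘(ℝ, EM)) (I' := 𝓘(ℝ, ℝ)) (x := x₀) (c := r)).smul ha.2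
  have h2 := (contMDiffAt_const (I := 𝓘(ℝ, EM)) (I' := 𝓘(ℝ, ℝ)) (x := x₀) (c := t)).smul hb.2
  refine (h1.add h2).congr_of_eventuallyEq ?_
  filter_upwards [hmem] with x hx
  have hl := (trivializationAt FV V (k x₀)).linear ℝ hx
  change (trivializationAt FV V (k x₀) ⟨k x, r • a x + t • b x⟩).2 = _
  rw [hl.map_add, hl.map_smul, hl.map_smul]
  rfl

/-- The right invariant section `c_{t(g)} · 0_g` of `V` defined by a smooth section of the core. -/
theorem exists_right_invariant {c : ∀ x, 𝒱.core x} (hc : 𝒱.IsSmoothCoreSection c) :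
    ∃ Z : 𝒱.algV.Sections, (∀ g, 𝒱.srcMap g (Z g) = 0) ∧
      ∀ g, 𝒱.tgtMap g (Z g) = 𝒱.coreAnchor _ (c (𝒱.base.tgt g)) := by
  have w : ∀ g : G, 𝒱.total.src (⟨𝒱.base.unit (𝒱.base.tgt g), (c (𝒱.base.tgt g)).1⟩ : TotalSpace FV V) =
      𝒱.total.tgt (⟨g, 0⟩ : TotalSpace FV V) := by
    intro g
    rw [𝒱.src_mk, 𝒱.tgt_mk, LinearMap.mem_ker.1 (c (𝒱.base.tgt g)).2, map_zero]
    exact mk_zero_congr (𝒱.base.src_unit _)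
  have h1 : ContMDiff 𝓘(ℝ, EG) (𝓘(ℝ, EG).prod 𝓘(ℝ, FV)) ∞
      fun g => 𝒱.total.comp (⟨𝒱.base.unit (𝒱.base.tgt g), (c (𝒱.base.tgt g)).1⟩ : TotalSpace FV V) ⟨g, 0⟩ (w g) :=
    𝒱.total.contMDiff_comp (hc.comp 𝒱.isMorphism_tgt.contMDiff_base)
      (contMDiff_zeroSection ℝ V) w
  have hp : ∀ g, (𝒱.total.comp (⟨𝒱.base.unit (𝒱.base.tgt g), (c (𝒱.base.tgt g)).1⟩ : TotalSpace FV V) ⟨g, 0⟩ (w g)).proj = g := by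
    intro g
    rw [𝒱.proj_comp]
    exact 𝒱.base.unit_comp g _
  have hz : ∀ g, ∃ z : V g, (⟨g, z⟩ : TotalSpace FV V) =
      𝒱.total.comp (⟨𝒱.base.unit (𝒱.base.tgt g), (c (𝒱.base.tgt g)).1⟩ : TotalSpace FV V) ⟨g, 0⟩ (w g) := by
    intro g
    have := hp g
    generalize 𝒱.total.comp (⟨𝒱.base.unit (𝒱.base.tgt g), (c (𝒱.base.tgt g)).1⟩ : TotalSpace FV V) ⟨g, 0⟩ (w g) = u at this
    obtain ⟨g', z⟩ := u
    obtain rfl : g' = g := this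
    exact ⟨z, rfl⟩
  choose Z hZ using hz
  refine ⟨(⟨Z, ?_⟩ : Cₛ^∞⟮𝓘(ℝ, EG); FV, V⟯), fun g => ?_, fun g => ?_⟩
  · exact h1.congr hZ
  · change 𝒱.srcMap g (Z g) = 0
    refine TotalSpace.mk_injective (F := FE) _ ?_
    rw [← 𝒱.src_mk, hZ, 𝒱.total.src_comp, 𝒱.total_mk_zero_src]
  · change 𝒱.tgtMap g (Z g) = _
    refine TotalSpace.mk_injective (F := FE) _ ?_
    rw [← 𝒱.tgt_mk, hZ, 𝒱.total.tgt_comp, 𝒱.tgt_mk, 𝒱.mk_coreAnchor]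

theorem srcMap_lie_eq_zero {X Y : 𝒱.algV.Sections} (hX : ∀ g, 𝒱.srcMap g (X g) = 0)
    (hY : ∀ g, 𝒱.srcMap g (Y g) = 0) (g : G) : 𝒱.srcMap g (⁅X, Y⁆ g) = 0 := by
  have := 𝒱.isMorphism_src.bracket 0 0 X Y Fin.elim0 Fin.elim0 Fin.elim0 Fin.elim0
    (by simpa using hX) (by simpa using hY) g
  simpa using this

theorem tgtMap_lie {X Y : 𝒱.algV.Sections} {X' Y' : 𝒱.algE.Sections}
    (hX : ∀ g, 𝒱.tgtMap g (X g) = X' (𝒱.base.tgt g))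
    (hY : ∀ g, 𝒱.tgtMap g (Y g) = Y' (𝒱.base.tgt g)) (g : G) :
    𝒱.tgtMap g (⁅X, Y⁆ g) = ⁅X', Y'⁆ (𝒱.base.tgt g) := by
  have h0 : ∀ v : TangentSpace 𝓘(ℝ, EG) g,
      dirDeriv (1 : C^∞⟮𝓘(ℝ, EG), G; 𝓘(ℝ, ℝ), ℝ⟯) g v = 0 := by
    intro v
    change mfderiv 𝓘(ℝ, EG) 𝓘(ℝ, ℝ) (fun _ : G => (1 : ℝ)) g v = 0
    rw [mfderiv_const]; rfl
  have := 𝒱.isMorphism_tgt.bracket 1 1 X Y (fun _ => 1) (fun _ => 1) (fun _ => X') (fun _ => Y')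
    (by simpa using hX) (by simpa using hY) g
  simpa [h0] using this

/-- The Lie algebra `Γ(C)` of sections of the core, regarded as a Lie subalgebra of `Γ(E)` by means
of the core-anchor map: it consists of the sections `∂ ∘ c`, `c` a smooth section of the core. -/
def coreSections : LieSubalgebra ℝ 𝒱.algE.Sections where
  carrier := {X | ∃ c, 𝒱.IsSmoothCoreSection c ∧ ∀ x, X x = 𝒱.coreAnchor x (c x)}
  add_mem' := by
    rintro X Y ⟨c, hc, hX⟩ ⟨d, hd, hY⟩
    refine ⟨fun x => c x + d x, ?_, fun x => ?_⟩
    · exact (contMDiff_lin_comb 1 1 hc hd).congr fun x => by simp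
    · rw [LieAlgebroid.Sections.add_apply, hX, hY, map_add]
  zero_mem' := by
    refine ⟨fun x => 0, ?_, fun x => ?_⟩
    · exact (contMDiff_zeroSection ℝ V).comp 𝒱.isMorphism_unit.contMDiff_base
    · rw [LieAlgebroid.Sections.zero_apply, map_zero]
  smul_mem' := by
    rintro r X ⟨c, hc, hX⟩
    refine ⟨fun x => r • c x, ?_, fun x => ?_⟩
    · exact (contMDiff_lin_comb r 0 hc hc).congr fun x => by simp
    · rw [LieAlgebroid.Sections.smul_apply, hX, map_smul]
  lie_mem' := by
    rintro X Y ⟨c, hc, hX⟩ ⟨d, hd, hY⟩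
    obtain ⟨Z, hZs, hZt⟩ := 𝒱.exists_right_invariant hc
    obtain ⟨W, hWs, hWt⟩ := 𝒱.exists_right_invariant hd
    refine ⟨fun x => ⟨⁅Z, W⁆ (𝒱.base.unit x), 𝒱.srcMap_lie_eq_zero hZs hWs _⟩, ?_, fun x => ?_⟩
    · exact (LieAlgebroid.Sections.contMDiff ⁅Z, W⁆).comp 𝒱.isMorphism_unit.contMDiff_base
    · refine TotalSpace.mk_injective (F := FE) _ ?_
      rw [𝒱.mk_coreAnchor]
      dsimp only
      rw [𝒱.tgtMap_lie (X' := X) (Y' := Y) (fun g => by rw [hZt, hX]) (fun g => by rw [hWt, hY]),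
        𝒱.base.tgt_unit]

section Smooth

variable [FiniteDimensional ℝ FV] [FiniteDimensional ℝ FE]

theorem contMDiffAt_clm {N EN HN W : Type*} [NormedAddCommGroup EN] [NormedSpace ℝ EN]
    [TopologicalSpace HN] {IN : ModelWithCorners ℝ EN HN} [TopologicalSpace N] [ChartedSpace HN N]
    [NormedAddCommGroup W] [NormedSpace ℝ W] {F : Type*} [NormedAddCommGroup F] [NormedSpace ℝ F]
    [FiniteDimensional ℝ F] {A : N → F →L[ℝ] W} {n₀ : N}
    (h : ∀ w, ContMDiffAt IN 𝓘(ℝ, W) ∞ (fun n => A n w) n₀) :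
    ContMDiffAt IN 𝓘(ℝ, F →L[ℝ] W) ∞ A n₀ := by
  let b := Module.finBasis ℝ F
  let co : ∀ i, F →L[ℝ] ℝ := fun i => LinearMap.toContinuousLinearMap (b.coord i)
  have hA : A = fun n => ∑ i, ContinuousLinearMap.smulRightL ℝ F W (co i) (A n (b i)) := by
    funext n
    ext w
    refine (congrArg (A n) (b.sum_repr w).symm).trans ?_
    rw [map_sum, sum_apply]
    exact Finset.sum_congr rfl fun i _ => by rw [map_smul]; rfl
  rw [hA]
  have hi : ∀ i ∈ Finset.univ, ContMDiffAt IN 𝓘(ℝ, F →L[ℝ] W) ∞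
      (fun n => ContinuousLinearMap.smulRightL ℝ F W (co i) (A n (b i))) n₀ := fun i _ =>
    ((ContinuousLinearMap.smulRightL ℝ F W (co i)).contDiff.contMDiff.contMDiffAt).comp n₀ (h (b i))
  exact contMDiffAt_finsetSum hi

/-- A family of elements of `V` along a smooth map into `G` is smooth if its images under `s̃` and
`t̃` are, provided that it is determined by these images. -/
theorem contMDiff_of_src_tgt {N EN HN : Type*} [NormedAddCommGroup EN] [NormedSpace ℝ EN]
    [TopologicalSpace HN] {IN : ModelWithCorners ℝ EN HN} [TopologicalSpace N] [ChartedSpace HN N]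
    {k : N → G} (hk : ContMDiff IN 𝓘(ℝ, EG) ∞ k) (v : ∀ n, V (k n))
    (hs : ContMDiff IN (𝓘(ℝ, EM).prod 𝓘(ℝ, FE)) ∞
      fun n => (⟨𝒱.base.src (k n), 𝒱.srcMap _ (v n)⟩ : TotalSpace FE E))
    (ht : ContMDiff IN (𝓘(ℝ, EM).prod 𝓘(ℝ, FE)) ∞
      fun n => (⟨𝒱.base.tgt (k n), 𝒱.tgtMap _ (v n)⟩ : TotalSpace FE E))
    (hinj : ∀ n (u : V (k n)), 𝒱.srcMap _ u = 0 → 𝒱.tgtMap _ u = 0 → u = 0) :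
    ContMDiff IN (𝓘(ℝ, EG).prod 𝓘(ℝ, FV)) ∞ fun n => (⟨k n, v n⟩ : TotalSpace FV V) := by
  intro n₀
  set g₀ := k n₀ with hg₀
  let eV := trivializationAt FV V g₀
  let eS := trivializationAt FE E (𝒱.base.src g₀)
  let eT := trivializationAt FE E (𝒱.base.tgt g₀)
  have hsg : ContMDiff 𝓘(ℝ, EG) 𝓘(ℝ, EM) ∞ 𝒱.base.src := 𝒱.isMorphism_src.contMDiff_base
  have htg : ContMDiff 𝓘(ℝ, EG) 𝓘(ℝ, EM) ∞ 𝒱.base.tgt := 𝒱.isMorphism_tgt.contMDiff_base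
  have mV : ∀ᶠ g in 𝓝 g₀, g ∈ eV.baseSet :=
    eV.open_baseSet.mem_nhds (mem_baseSet_trivializationAt FV V _)
  have mS : ∀ᶠ g in 𝓝 g₀, 𝒱.base.src g ∈ eS.baseSet :=
    hsg.continuous.continuousAt.eventually
      (eS.open_baseSet.mem_nhds (mem_baseSet_trivializationAt FE E _))
  have mT : ∀ᶠ g in 𝓝 g₀, 𝒱.base.tgt g ∈ eT.baseSet :=
    htg.continuous.continuousAt.eventually
      (eT.open_baseSet.mem_nhds (mem_baseSet_trivializationAt FE E _))
  let A : G → FV →L[ℝ] FE × FE := fun g => LinearMap.toContinuousLinearMap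
    (((eS.linearMapAt ℝ (𝒱.base.src g)) ∘ₗ 𝒱.srcMap g ∘ₗ eV.symmₗ ℝ g).prod
      ((eT.linearMapAt ℝ (𝒱.base.tgt g)) ∘ₗ 𝒱.tgtMap g ∘ₗ eV.symmₗ ℝ g))
  have hAap : ∀ g w, A g w = (eS.linearMapAt ℝ (𝒱.base.src g) (𝒱.srcMap g (eV.symmₗ ℝ g w)),
      eT.linearMapAt ℝ (𝒱.base.tgt g) (𝒱.tgtMap g (eV.symmₗ ℝ g w))) := by
    intro g w
    rfl
  have hsec : ∀ w : FV, ContMDiffAt 𝓘(ℝ, EG) (𝓘(ℝ, EG).prod 𝓘(ℝ, FV)) ∞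
      (fun g => (⟨g, eV.symmₗ ℝ g w⟩ : TotalSpace FV V)) g₀ := by
    intro w
    refine contMDiffAt_totalSpace.2 ⟨contMDiffAt_id, ?_⟩
    refine (contMDiffAt_const (c := w)).congr_of_eventuallyEq ?_
    filter_upwards [mV] with g hg
    change (eV ⟨g, eV.symmₗ ℝ g w⟩).2 = w
    rw [eV.symmₗ_apply (R := ℝ) hg]
    exact congrArg Prod.snd (eV.apply_mk_symm hg w)
  have hA : ContMDiffAt 𝓘(ℝ, EG) 𝓘(ℝ, FV →L[ℝ] FE × FE) ∞ A g₀ := by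
    refine contMDiffAt_clm fun w => ?_
    have h1 := (contMDiffAt_totalSpace.1
      ((𝒱.isMorphism_src.contMDiff.contMDiffAt).comp g₀ (hsec w))).2
    have h2 := (contMDiffAt_totalSpace.1
      ((𝒱.isMorphism_tgt.contMDiff.contMDiffAt).comp g₀ (hsec w))).2
    refine (h1.prodMk_space h2).congr_of_eventuallyEq ?_
    filter_upwards [mS, mT] with g hS hT
    refine Prod.ext ?_ ?_
    · exact congrFun (eS.coe_linearMapAt_of_mem (R := ℝ) hS) _
    · exact congrFun (eT.coe_linearMapAt_of_mem (R := ℝ) hT) _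
  have hAinj : LinearMap.ker (A g₀ : FV →ₗ[ℝ] FE × FE) = ⊥ := by
    rw [LinearMap.ker_eq_bot']
    intro w hw
    replace hw : A g₀ w = 0 := hw
    rw [hAap] at hw
    have h1 : eS.linearMapAt ℝ (𝒱.base.src g₀) (𝒱.srcMap g₀ (eV.symmₗ ℝ g₀ w)) = 0 :=
      congrArg Prod.fst hw
    have h2 : eT.linearMapAt ℝ (𝒱.base.tgt g₀) (𝒱.tgtMap g₀ (eV.symmₗ ℝ g₀ w)) = 0 :=
      congrArg Prod.snd hw
    have h3 : 𝒱.srcMap g₀ (eV.symmₗ ℝ g₀ w) = 0 := by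
      have := congrArg (eS.symmₗ ℝ (𝒱.base.src g₀)) h1
      rwa [map_zero, Trivialization.symmₗ_linearMapAt _ mS.self_of_nhds] at this
    have h4 : 𝒱.tgtMap g₀ (eV.symmₗ ℝ g₀ w) = 0 := by
      have := congrArg (eT.symmₗ ℝ (𝒱.base.tgt g₀)) h2
      rwa [map_zero, Trivialization.symmₗ_linearMapAt _ mT.self_of_nhds] at this
    have h5 : eV.symmₗ ℝ g₀ w = 0 := hinj n₀ _ h3 h4
    have h6 := eV.linearMapAt_symmₗ (R := ℝ) mV.self_of_nhds w
    rw [← h6]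
    exact (congrArg (eV.linearMapAt ℝ g₀) h5).trans (map_zero _)
  obtain ⟨L, hL⟩ := LinearMap.exists_leftInverse_of_injective (A g₀ : FV →ₗ[ℝ] FE × FE) hAinj
  let L' : FE × FE →L[ℝ] FV := LinearMap.toContinuousLinearMap L
  let D : N → FV →L[ℝ] FV := fun n => L' ∘L A (k n)
  have hD : ContMDiffAt IN 𝓘(ℝ, FV →L[ℝ] FV) ∞ D n₀ :=
    ((ContinuousLinearMap.compL ℝ FV (FE × FE) FV L').contDiff.contMDiff.contMDiffAt).comp n₀
      (hA.comp n₀ (hk n₀))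
  have hD0 : D n₀ = ContinuousLinearEquiv.refl ℝ FV := by
    ext w
    exact LinearMap.congr_fun hL w
  have hDe : ∀ᶠ n in 𝓝 n₀, D n ∈ range ((↑) : (FV ≃L[ℝ] FV) → FV →L[ℝ] FV) := by
    refine hD.continuousAt.eventually ?_
    rw [hD0]
    exact ContinuousLinearEquiv.nhds _
  have hinv : ContMDiffAt IN 𝓘(ℝ, FV →L[ℝ] FV) ∞ (fun n => ContinuousLinearMap.inverse (D n))
      n₀ := by
    have h1 : ContDiffAt ℝ ∞ (ContinuousLinearMap.inverse : (FV →L[ℝ] FV) → _) (D n₀) := by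
      rw [hD0]
      exact contDiffAt_map_inverse _
    exact h1.contMDiffAt.comp n₀ hD
  have hs' := (contMDiffAt_totalSpace.1 (hs n₀)).2
  have ht' := (contMDiffAt_totalSpace.1 (ht n₀)).2
  have hy := (L'.contDiff.contMDiff.contMDiffAt).comp n₀ (hs'.prodMk_space ht')
  refine contMDiffAt_totalSpace.2 ⟨hk n₀, (hinv.clm_apply hy).congr_of_eventuallyEq ?_⟩
  have hkc := hk.continuous.continuousAt (x := n₀)
  filter_upwards [hDe, hkc.eventually mV, hkc.eventually mS, hkc.eventually mT] with n hn hV hS hT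
  obtain ⟨e, he⟩ := hn
  rw [← he, ContinuousLinearMap.inverse_equiv]
  change (eV ⟨k n, v n⟩).2 = e.symm _
  rw [ContinuousLinearEquiv.eq_symm_apply]
  change (e : FV →L[ℝ] FV) _ = _
  rw [he]
  change L' (A (k n) _) = L' _
  rw [hAap, eV.symmₗ_apply (R := ℝ) hV, eV.symm_apply_apply_mk hV]
  refine congrArg L' (Prod.ext ?_ ?_)
  · exact congrFun (eS.coe_linearMapAt_of_mem (R := ℝ) hS) _
  · exact congrFun (eT.coe_linearMapAt_of_mem (R := ℝ) hT) _

theorem mem_coreSections_iff (h𝒱 : 𝒱.InjectiveCoreAnchor) (X : 𝒱.algE.Sections) :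
    X ∈ 𝒱.coreSections ↔ ∀ x, X x ∈ 𝒱.coreImage x := by
  constructor
  · rintro ⟨c, -, hX⟩ x
    exact ⟨c x, (hX x).symm⟩
  · intro h
    choose c hc using h
    refine ⟨c, ?_, fun x => (hc x).symm⟩
    refine 𝒱.contMDiff_of_src_tgt 𝒱.isMorphism_unit.contMDiff_base (fun x => (c x).1) ?_ ?_ ?_
    · refine (contMDiff_zeroSection ℝ E).congr fun x => ?_
      rw [LinearMap.mem_ker.1 (c x).2]
      exact mk_zero_congr (𝒱.base.src_unit x)
    · refine X.contMDiff.congr fun x => ?_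
      rw [← hc, 𝒱.mk_coreAnchor]
    · intro x u hu hu'
      have : (⟨u, hu⟩ : 𝒱.core x) = 0 := by
        refine h𝒱 x (TotalSpace.mk_injective (F := FE) _ ?_)
        rw [𝒱.mk_coreAnchor, map_zero, hu']
        exact mk_zero_congr (𝒱.base.tgt_unit x)
      exact congrArg Subtype.val this

end Smooth

/-- The space `Γ(N₀)` of smooth sections of the normal bundle `N₀ = E / C`: the sections which are
locally represented by smooth sections of `E`. -/
def normalSections : Submodule ℝ (∀ x, 𝒱.N₀ x) where
  carrier := {l | ∀ x₀ : M, ∃ U ∈ 𝓝 x₀, ∃ s : ∀ x, E x,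
    ContMDiffOn 𝓘(ℝ, EM) (𝓘(ℝ, EM).prod 𝓘(ℝ, FE)) ∞ (fun x => (⟨x, s x⟩ : TotalSpace FE E)) U ∧
    ∀ x ∈ U, Submodule.Quotient.mk (s x) = l x}
  add_mem' := by
    intro l l' hl hl' x₀
    obtain ⟨U, hU, s, hs, h⟩ := hl x₀
    obtain ⟨U', hU', s', hs', h'⟩ := hl' x₀
    refine ⟨U ∩ U', Filter.inter_mem hU hU', s + s', ?_, fun x hx => ?_⟩
    · exact (hs.mono inter_subset_left).add_section (hs'.mono inter_subset_right)
    · rw [Pi.add_apply, Submodule.Quotient.mk_add, h x hx.1, h' x hx.2, Pi.add_apply]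
  zero_mem' := fun x₀ => ⟨univ, Filter.univ_mem, fun _ => 0,
    (contMDiff_zeroSection ℝ E).contMDiffOn, fun _ _ => rfl⟩
  smul_mem' := by
    intro r l hl x₀
    obtain ⟨U, hU, s, hs, h⟩ := hl x₀
    refine ⟨U, hU, r • s, hs.const_smul_section, fun x hx => ?_⟩
    rw [Pi.smul_apply, Submodule.Quotient.mk_smul, h x hx, Pi.smul_apply]

/-- The projection `Γ(E) → Γ(N₀)`, `X ↦ X̄`. -/
noncomputable def toNormal : 𝒱.algE.Sections →ₗ[ℝ] 𝒱.normalSections where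
  toFun X := ⟨fun x => Submodule.Quotient.mk (X x), fun _ =>
    ⟨univ, Filter.univ_mem, fun x => X x, X.contMDiff.contMDiffOn, fun _ _ => rfl⟩⟩
  map_add' _ _ := rfl
  map_smul' _ _ := rfl

section Bott

variable [FiniteDimensional ℝ FV] [FiniteDimensional ℝ FE]

theorem toNormal_eq_zero_iff (h𝒱 : 𝒱.InjectiveCoreAnchor) (X : 𝒱.algE.Sections) :
    𝒱.toNormal X = 0 ↔ X ∈ 𝒱.coreSections := by
  rw [𝒱.mem_coreSections_iff h𝒱]
  constructor
  · intro h x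
    have := congrFun (congrArg Subtype.val h) x
    exact (Submodule.Quotient.mk_eq_zero _).1 this
  · intro h
    exact Subtype.ext (funext fun x => (Submodule.Quotient.mk_eq_zero _).2 (h x))

theorem toNormal_eq_iff (h𝒱 : 𝒱.InjectiveCoreAnchor) (X Y : 𝒱.algE.Sections) :
    𝒱.toNormal X = 𝒱.toNormal Y ↔ X - Y ∈ 𝒱.coreSections := by
  rw [← 𝒱.toNormal_eq_zero_iff h𝒱, map_sub, sub_eq_zero]

variable [FiniteDimensional ℝ EM] [T2Space M] [SigmaCompactSpace M]

theorem toNormal_surjective : Function.Surjective 𝒱.toNormal := by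
  intro l
  obtain ⟨s, hs⟩ := exists_contMDiffSection_forall_mem_convex_of_local (n := ⊤) 𝓘(ℝ, EM) E
    (fun x => {e : E x | Submodule.Quotient.mk e = l.1 x})
    (fun x e he f hf a b _ _ hab => by
      simp only [mem_ofPred_eq] at he hf ⊢
      rw [Submodule.Quotient.mk_add, Submodule.Quotient.mk_smul, Submodule.Quotient.mk_smul, he, hf,
        ← add_smul, hab, one_smul])
    l.2
  exact ⟨s, Subtype.ext (funext hs)⟩

/-- The Bott representation `∇ : Γ(C) × Γ(N₀) → Γ(N₀)` of `C` on `N₀ = E / C`; it is defined by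
`∇_X Ȳ = \overline{[X, Y]}`. -/
noncomputable def bott (h𝒱 : 𝒱.InjectiveCoreAnchor) :
    𝒱.coreSections →ₗ[ℝ] 𝒱.normalSections →ₗ[ℝ] 𝒱.normalSections :=
  have key : ∀ (X : 𝒱.coreSections) (Y Y' : 𝒱.algE.Sections), 𝒱.toNormal Y = 𝒱.toNormal Y' →
      𝒱.toNormal ⁅(X : 𝒱.algE.Sections), Y⁆ = 𝒱.toNormal ⁅(X : 𝒱.algE.Sections), Y'⁆ := by
    intro X Y Y' h
    rw [𝒱.toNormal_eq_iff h𝒱] at h ⊢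
    rw [← lie_sub]
    exact 𝒱.coreSections.lie_mem X.2 h
  LinearMap.mk₂ ℝ
    (fun X l => 𝒱.toNormal
      ⁅(X : 𝒱.algE.Sections), Function.surjInv 𝒱.toNormal_surjective l⁆)
    (fun X X' l => by rw [← map_add, ← add_lie]; rfl)
    (fun r X l => by rw [← map_smul, ← smul_lie]; rfl)
    (fun X l l' => by
      rw [← map_add, ← lie_add]
      exact key X _ _ (by rw [map_add, Function.surjInv_eq 𝒱.toNormal_surjective,
        Function.surjInv_eq 𝒱.toNormal_surjective, Function.surjInv_eq 𝒱.toNormal_surjective]))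
    (fun r X l => by
      rw [← map_smul, ← lie_smul]
      exact key X _ _ (by rw [map_smul, Function.surjInv_eq 𝒱.toNormal_surjective,
        Function.surjInv_eq 𝒱.toNormal_surjective]))

theorem bott_toNormal (h𝒱 : 𝒱.InjectiveCoreAnchor) (X : 𝒱.coreSections) (Y : 𝒱.algE.Sections) :
    𝒱.bott h𝒱 X (𝒱.toNormal Y) = 𝒱.toNormal ⁅(X : 𝒱.algE.Sections), Y⁆ := by
  change 𝒱.toNormal ⁅(X : 𝒱.algE.Sections), Function.surjInv 𝒱.toNormal_surjective _⁆ = _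
  rw [𝒱.toNormal_eq_iff h𝒱, ← lie_sub]
  refine 𝒱.coreSections.lie_mem X.2 ?_
  rw [← 𝒱.toNormal_eq_iff h𝒱, Function.surjInv_eq 𝒱.toNormal_surjective]

/-- The space `Γ₀(E)` of Bott-flat sections of `N₀ = E / C`. -/
noncomputable def flatSections (h𝒱 : 𝒱.InjectiveCoreAnchor) : Submodule ℝ 𝒱.normalSections where
  carrier := {l | ∀ X, 𝒱.bott h𝒱 X l = 0}
  add_mem' hl hl' X := by rw [map_add, hl X, hl' X, add_zero]
  zero_mem' X := map_zero _
  smul_mem' r l hl X := by rw [map_smul, hl X, smul_zero]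

theorem toNormal_mem_flatSections_iff (h𝒱 : 𝒱.InjectiveCoreAnchor) (X : 𝒱.algE.Sections) :
    𝒱.toNormal X ∈ 𝒱.flatSections h𝒱 ↔ X ∈ 𝒱.coreSections.normalizer := by
  rw [LieSubalgebra.mem_normalizer_iff']
  constructor
  · intro h Y hY
    have := h ⟨Y, hY⟩
    rwa [𝒱.bott_toNormal, 𝒱.toNormal_eq_zero_iff h𝒱] at this
  · intro h Y
    rw [𝒱.bott_toNormal, 𝒱.toNormal_eq_zero_iff h𝒱]
    exact h Y Y.2

theorem exists_toNormal_eq (h𝒱 : 𝒱.InjectiveCoreAnchor) (l : 𝒱.flatSections h𝒱) :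
    ∃ X : 𝒱.coreSections.normalizer, 𝒱.toNormal X = l := by
  obtain ⟨X, hX⟩ := 𝒱.toNormal_surjective l.1
  refine ⟨⟨X, ?_⟩, hX⟩
  rw [← 𝒱.toNormal_mem_flatSections_iff h𝒱, hX]
  exact l.2

/-- The bracket of Bott-flat sections, given by `[X̄, Ȳ] = \overline{[X, Y]}`. -/
noncomputable instance (h𝒱 : 𝒱.InjectiveCoreAnchor) :
    Bracket (𝒱.flatSections h𝒱) (𝒱.flatSections h𝒱) where
  bracket l m := ⟨𝒱.toNormal ⁅((𝒱.exists_toNormal_eq h𝒱 l).choose : 𝒱.algE.Sections),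
      ((𝒱.exists_toNormal_eq h𝒱 m).choose : 𝒱.algE.Sections)⁆, by
    rw [𝒱.toNormal_mem_flatSections_iff h𝒱]
    exact LieSubalgebra.lie_mem _ (Subtype.property _) (Subtype.property _)⟩

theorem flat_lie_eq (h𝒱 : 𝒱.InjectiveCoreAnchor) (l m : 𝒱.flatSections h𝒱)
    (X Y : 𝒱.algE.Sections) (hX : 𝒱.toNormal X = l) (hY : 𝒱.toNormal Y = m) :
    ((⁅l, m⁆ : 𝒱.flatSections h𝒱) : 𝒱.normalSections) = 𝒱.toNormal ⁅X, Y⁆ := by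
  obtain ⟨X', hX', h1⟩ : ∃ X' : 𝒱.coreSections.normalizer, 𝒱.toNormal X' = l ∧
      X' = (𝒱.exists_toNormal_eq h𝒱 l).choose := ⟨_, (𝒱.exists_toNormal_eq h𝒱 l).choose_spec, rfl⟩
  obtain ⟨Y', hY', h2⟩ : ∃ Y' : 𝒱.coreSections.normalizer, 𝒱.toNormal Y' = m ∧
      Y' = (𝒱.exists_toNormal_eq h𝒱 m).choose := ⟨_, (𝒱.exists_toNormal_eq h𝒱 m).choose_spec, rfl⟩
  change 𝒱.toNormal ⁅((𝒱.exists_toNormal_eq h𝒱 l).choose : 𝒱.algE.Sections),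
    ((𝒱.exists_toNormal_eq h𝒱 m).choose : 𝒱.algE.Sections)⁆ = _
  rw [← h1, ← h2]
  have hYn : Y ∈ 𝒱.coreSections.normalizer := by
    rw [← 𝒱.toNormal_mem_flatSections_iff h𝒱, hY]; exact m.2
  have hXX : (X' : 𝒱.algE.Sections) - X ∈ 𝒱.coreSections := by
    rw [← 𝒱.toNormal_eq_iff h𝒱, hX', hX]
  have hYY : (Y' : 𝒱.algE.Sections) - Y ∈ 𝒱.coreSections := by
    rw [← 𝒱.toNormal_eq_iff h𝒱, hY', hY]
  rw [𝒱.toNormal_eq_iff h𝒱]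
  have e : ⁅(X' : 𝒱.algE.Sections), (Y' : 𝒱.algE.Sections)⁆ - ⁅X, Y⁆ =
      ⁅(X' : 𝒱.algE.Sections), (Y' : 𝒱.algE.Sections) - Y⁆ +
        ⁅(X' : 𝒱.algE.Sections) - X, Y⁆ := by
    rw [lie_sub, sub_lie]; abel
  rw [e]
  refine add_mem ?_ ?_
  · exact (LieSubalgebra.mem_normalizer_iff _ _).1 X'.2 _ hYY
  · exact (LieSubalgebra.mem_normalizer_iff' _ _).1 hYn _ hXX

/-- The Lie algebra structure of `Γ₀(E)`. -/
noncomputable instance (h𝒱 : 𝒱.InjectiveCoreAnchor) : LieRing (𝒱.flatSections h𝒱) where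
  add_lie l m k := by
    obtain ⟨X, hX⟩ := 𝒱.toNormal_surjective l.1
    obtain ⟨Y, hY⟩ := 𝒱.toNormal_surjective m.1
    obtain ⟨Z, hZ⟩ := 𝒱.toNormal_surjective k.1
    refine Subtype.ext ?_
    rw [Submodule.coe_add, 𝒱.flat_lie_eq h𝒱 l k X Z hX hZ, 𝒱.flat_lie_eq h𝒱 m k Y Z hY hZ,
      𝒱.flat_lie_eq h𝒱 (l + m) k (X + Y) Z (by rw [map_add, hX, hY]; rfl) hZ, add_lie, map_add]
  lie_add l m k := by
    obtain ⟨X, hX⟩ := 𝒱.toNormal_surjective l.1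
    obtain ⟨Y, hY⟩ := 𝒱.toNormal_surjective m.1
    obtain ⟨Z, hZ⟩ := 𝒱.toNormal_surjective k.1
    refine Subtype.ext ?_
    rw [Submodule.coe_add, 𝒱.flat_lie_eq h𝒱 l m X Y hX hY, 𝒱.flat_lie_eq h𝒱 l k X Z hX hZ,
      𝒱.flat_lie_eq h𝒱 l (m + k) X (Y + Z) hX (by rw [map_add, hY, hZ]; rfl), lie_add, map_add]
  lie_self l := by
    obtain ⟨X, hX⟩ := 𝒱.toNormal_surjective l.1
    refine Subtype.ext ?_
    rw [𝒱.flat_lie_eq h𝒱 l l X X hX hX, lie_self, map_zero]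
    rfl
  leibniz_lie l m k := by
    obtain ⟨X, hX⟩ := 𝒱.toNormal_surjective l.1
    obtain ⟨Y, hY⟩ := 𝒱.toNormal_surjective m.1
    obtain ⟨Z, hZ⟩ := 𝒱.toNormal_surjective k.1
    refine Subtype.ext ?_
    rw [Submodule.coe_add,
      𝒱.flat_lie_eq h𝒱 l ⁅m, k⁆ X ⁅Y, Z⁆ hX (𝒱.flat_lie_eq h𝒱 m k Y Z hY hZ).symm,
      𝒱.flat_lie_eq h𝒱 ⁅l, m⁆ k ⁅X, Y⁆ Z (𝒱.flat_lie_eq h𝒱 l m X Y hX hY).symm hZ,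
      𝒱.flat_lie_eq h𝒱 m ⁅l, k⁆ Y ⁅X, Z⁆ hY (𝒱.flat_lie_eq h𝒱 l k X Z hX hZ).symm,
      leibniz_lie, map_add]

noncomputable instance (h𝒱 : 𝒱.InjectiveCoreAnchor) : LieAlgebra ℝ (𝒱.flatSections h𝒱) where
  lie_smul r l m := by
    obtain ⟨X, hX⟩ := 𝒱.toNormal_surjective l.1
    obtain ⟨Y, hY⟩ := 𝒱.toNormal_surjective m.1
    refine Subtype.ext ?_
    rw [Submodule.coe_smul, 𝒱.flat_lie_eq h𝒱 l m X Y hX hY,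
      𝒱.flat_lie_eq h𝒱 l (r • m) X (r • Y) hX (by rw [map_smul, hY]; rfl), lie_smul, map_smul]

end Bott

/-- `Γ(C)` as an ideal of its normalizer `N(Γ(C))` in `Γ(E)`. -/
def coreIdeal : LieIdeal ℝ 𝒱.coreSections.normalizer where
  carrier := {X | (X : 𝒱.algE.Sections) ∈ 𝒱.coreSections}
  add_mem' hX hY := 𝒱.coreSections.add_mem hX hY
  zero_mem' := 𝒱.coreSections.zero_mem
  smul_mem' r _ hX := 𝒱.coreSections.smul_mem r hX
  lie_mem {X _} hY := (LieSubalgebra.mem_normalizer_iff _ _).1 X.2 _ hY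

/-- The space `Γ_bas(V)` of basic sections: the sections `λ` of `N₀` with `s̃^* λ = t̃^* λ`. -/
noncomputable def basicSections [FiniteDimensional ℝ FV] [FiniteDimensional ℝ FE] :
    Submodule ℝ 𝒱.normalSections where
  carrier := {l | 𝒱.srcPullback l.1 = 𝒱.tgtPullback l.1}
  add_mem' {l m} hl hm := by
    funext g
    have h1 := congrFun hl g
    have h2 := congrFun hm g
    simp only [VBGroupoid.srcPullback, VBGroupoid.tgtPullback] at h1 h2 ⊢
    rw [Submodule.coe_add, Pi.add_apply, Pi.add_apply, map_add, map_add, h1, h2]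
  zero_mem' := by
    funext g
    simp only [VBGroupoid.srcPullback, VBGroupoid.tgtPullback]
    rw [Submodule.coe_zero, Pi.zero_apply, Pi.zero_apply, map_zero, map_zero]
  smul_mem' r l hl := by
    funext g
    have h1 := congrFun hl g
    simp only [VBGroupoid.srcPullback, VBGroupoid.tgtPullback] at h1 ⊢
    rw [Submodule.coe_smul, Pi.smul_apply, Pi.smul_apply, map_smul, map_smul, h1]

end LAGroupoid

end LA

/-!
The three claims rest on lifting sections of `E` to sections of `V`.

Injectivity of the core-anchor map says that `ker s̃ ∩ ker t̃ = 0` over the units, and translating by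
zero elements of `V` gives the same over every arrow (`eq_zero_of_srcMap_of_tgtMap`). Call `W ∈ Γ(V)`
a *lift* of `Y ∈ Γ(E)` if `s̃ ∘ W = Y ∘ s` and `t̃ ∘ W = Y ∘ t`. A lift is unique, and
`toNormal_mem_basicSections_iff` shows that `Y` has a lift exactly when `Ȳ` is basic: over a single
arrow an element of `V` with the required images exists if and only if `s̃^* Ȳ = t̃^* Ȳ` there, and
these elements automatically form a smooth section because they are determined by their images under
`s̃` and `t̃`, which vary smoothly.

Since `s̃` and `t̃` are Lie algebroid morphisms, the bracket of two lifts is a lift of the bracket; so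
basic sections are closed under the bracket once they are known to be flat. For flatness, let
`X ∈ Γ(C)` have the right invariant section `Z`, with `s̃ ∘ Z = 0` and `t̃ ∘ Z = X ∘ t`, and let `W`
be a lift of `Y`. Then `s̃ ∘ [Z, W] = 0` and `t̃ ∘ [Z, W] = [X, Y] ∘ t`, which puts `[X, Y]` in `C`.

The isomorphism `N(Γ(C)) / Γ(C) ≅ Γ₀(E)` is the first isomorphism theorem for `X ↦ X̄`: partitions of
unity make `Γ(E) → Γ(N₀)` surjective, its kernel is `Γ(C)`, and the preimage of the flat sections is
the normalizer.
-/

namespace LieHom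

/-- The first isomorphism theorem for a surjective homomorphism of Lie algebras with kernel `I`. -/
theorem exists_quotient_equiv_of_surjective {R L L' : Type*} [CommRing R] [LieRing L]
    [LieAlgebra R L] [LieRing L'] [LieAlgebra R L'] (f : L →ₗ⁅R⁆ L') (hf : Function.Surjective f)
    (I : LieIdeal R L) (hI : ∀ x, x ∈ I ↔ f x = 0) :
    ∃ φ : (L ⧸ I) ≃ₗ⁅R⁆ L', ∀ x, φ (LieSubmodule.Quotient.mk x) = f x := by
  obtain rfl : f.ker = I := LieSubmodule.ext _ _ fun x => by rw [LieHom.mem_ker, hI]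
  have hr : f.range = ⊤ := (LieHom.range_eq_top f).2 hf
  exact ⟨f.quotKerEquivRange.trans ((LieEquiv.ofEq _ _ (congrArg _ hr)).trans
    LieSubalgebra.topEquiv), fun x => rfl⟩

end LieHom

section LA

namespace LAGroupoid

variable {EG EM EG₂ FV FE FV₂ : Type*}
    [NormedAddCommGroup EG] [NormedSpace ℝ EG] [NormedAddCommGroup EM] [NormedSpace ℝ EM]
    [NormedAddCommGroup EG₂] [NormedSpace ℝ EG₂] [NormedAddCommGroup FV] [NormedSpace ℝ FV]
    [NormedAddCommGroup FE] [NormedSpace ℝ FE] [NormedAddCommGroup FV₂] [NormedSpace ℝ FV₂]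
    {G M G₂ : Type*}
    [TopologicalSpace G] [ChartedSpace EG G] [IsManifold 𝓘(ℝ, EG) ∞ G]
    [TopologicalSpace M] [ChartedSpace EM M] [IsManifold 𝓘(ℝ, EM) ∞ M]
    [TopologicalSpace G₂] [ChartedSpace EG₂ G₂] [IsManifold 𝓘(ℝ, EG₂) ∞ G₂]
    {V : G → Type*} {E : M → Type*} {V₂ : G₂ → Type*}
    [TopologicalSpace (TotalSpace FV V)] [∀ g, TopologicalSpace (V g)]
    [∀ g, AddCommGroup (V g)] [∀ g, Module ℝ (V g)] [FiberBundle FV V]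
    [VectorBundle ℝ FV V] [ContMDiffVectorBundle ∞ FV V 𝓘(ℝ, EG)]
    [TopologicalSpace (TotalSpace FE E)] [∀ x, TopologicalSpace (E x)]
    [∀ x, AddCommGroup (E x)] [∀ x, Module ℝ (E x)] [FiberBundle FE E]
    [VectorBundle ℝ FE E] [ContMDiffVectorBundle ∞ FE E 𝓘(ℝ, EM)]
    [TopologicalSpace (TotalSpace FV₂ V₂)] [∀ p, TopologicalSpace (V₂ p)]
    [∀ p, AddCommGroup (V₂ p)] [∀ p, Module ℝ (V₂ p)] [FiberBundle FV₂ V₂]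
    [VectorBundle ℝ FV₂ V₂] [ContMDiffVectorBundle ∞ FV₂ V₂ 𝓘(ℝ, EG₂)]
    (𝒱 : LAGroupoid EG EM EG₂ FV FE FV₂ V E V₂)

/-- Over every arrow the kernels of `s̃` and `t̃` meet trivially: translation by the zero element over
the inverse arrow reduces this to the units. -/
theorem eq_zero_of_srcMap_of_tgtMap (h𝒱 : 𝒱.InjectiveCoreAnchor) (g : G) (v : V g)
    (hs : 𝒱.srcMap g v = 0) (ht : 𝒱.tgtMap g v = 0) : v = 0 := by
  have w₀ : 𝒱.base.src g = 𝒱.base.tgt (𝒱.base.inv g) := (𝒱.base.tgt_inv g).symm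
  have w : ∀ u : V g, 𝒱.srcMap g u = 0 → 𝒱.total.src (⟨g, u⟩ : TotalSpace FV V) =
      𝒱.total.tgt (⟨𝒱.base.inv g, 0⟩ : TotalSpace FV V) := fun u hu => by
    rw [𝒱.src_mk, hu, 𝒱.total_mk_zero_tgt]
    exact mk_zero_congr w₀
  -- every element killed by `s̃` and `t̃` has the same translate
  have key : ∀ (u : V g) (hu : 𝒱.srcMap g u = 0), 𝒱.tgtMap g u = 0 →
      𝒱.total.comp ⟨g, u⟩ ⟨𝒱.base.inv g, 0⟩ (w u hu) =
        (⟨𝒱.base.unit (𝒱.base.tgt g), 0⟩ : TotalSpace FV V) := by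
    intro u hu hu'
    have hp : (𝒱.total.comp ⟨g, u⟩ ⟨𝒱.base.inv g, 0⟩ (w u hu)).proj =
        𝒱.base.unit (𝒱.base.tgt g) := by
      rw [𝒱.proj_comp]; exact 𝒱.base.comp_inv g w₀
    have hcs := 𝒱.total.src_comp _ _ (w u hu)
    have hct := 𝒱.total.tgt_comp _ _ (w u hu)
    generalize 𝒱.total.comp ⟨g, u⟩ ⟨𝒱.base.inv g, 0⟩ (w u hu) = c at hp hcs hct
    obtain ⟨k, c⟩ := c
    obtain rfl : k = 𝒱.base.unit (𝒱.base.tgt g) := hp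
    rw [𝒱.total_mk_zero_src, 𝒱.src_mk] at hcs
    rw [𝒱.tgt_mk, 𝒱.tgt_mk, hu'] at hct
    have hc : 𝒱.srcMap _ c = 0 := TotalSpace.mk_injective (F := FE) _
      (hcs.trans (mk_zero_congr ((𝒱.base.src_inv g).trans (𝒱.base.src_unit _).symm)))
    have h0 : (⟨c, hc⟩ : 𝒱.core (𝒱.base.tgt g)) = 0 := by
      refine h𝒱 _ (TotalSpace.mk_injective (F := FE) _ ?_)
      rw [𝒱.mk_coreAnchor, map_zero, hct]
    exact congrArg _ (congrArg Subtype.val h0)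
  exact TotalSpace.mk_injective (F := FV) g (𝒱.total.comp_right_cancel (w v hs) (w 0 (map_zero _))
    ((key v hs ht).trans (key 0 (map_zero _) (map_zero _)).symm))

theorem srcMap_lie {X Y : 𝒱.algV.Sections} {X' Y' : 𝒱.algE.Sections}
    (hX : ∀ g, 𝒱.srcMap g (X g) = X' (𝒱.base.src g))
    (hY : ∀ g, 𝒱.srcMap g (Y g) = Y' (𝒱.base.src g)) (g : G) :
    𝒱.srcMap g (⁅X, Y⁆ g) = ⁅X', Y'⁆ (𝒱.base.src g) := by
  have h0 : ∀ v : TangentSpace 𝓘(ℝ, EG) g,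
      dirDeriv (1 : C^∞⟮𝓘(ℝ, EG), G; 𝓘(ℝ, ℝ), ℝ⟯) g v = 0 := by
    intro v
    change mfderiv 𝓘(ℝ, EG) 𝓘(ℝ, ℝ) (fun _ : G => (1 : ℝ)) g v = 0
    rw [mfderiv_const]; rfl
  have := 𝒱.isMorphism_src.bracket 1 1 X Y (fun _ => 1) (fun _ => 1) (fun _ => X') (fun _ => Y')
    (by simpa using hX) (by simpa using hY) g
  simpa [h0] using this

/-- The section `W` of `V` lifts the section `Y` of `E`: it is related to `Y` both by `s̃` and by
`t̃`. -/
def IsLift (W : 𝒱.algV.Sections) (Y : 𝒱.algE.Sections) : Prop :=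
  ∀ g, 𝒱.srcMap g (W g) = Y (𝒱.base.src g) ∧ 𝒱.tgtMap g (W g) = Y (𝒱.base.tgt g)

variable {𝒱} in
theorem IsLift.lie {W W' : 𝒱.algV.Sections} {Y Y' : 𝒱.algE.Sections} (h : 𝒱.IsLift W Y)
    (h' : 𝒱.IsLift W' Y') : 𝒱.IsLift ⁅W, W'⁆ ⁅Y, Y'⁆ := fun g =>
  ⟨𝒱.srcMap_lie (fun k => (h k).1) (fun k => (h' k).1) g,
    𝒱.tgtMap_lie (fun k => (h k).2) (fun k => (h' k).2) g⟩

variable {𝒱} in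
/-- Bracketing a lift of `Y` with the right invariant section of `X` shows that `[X, Y]` is a section
of the core. -/
theorem IsLift.mem_normalizer [FiniteDimensional ℝ FV] [FiniteDimensional ℝ FE]
    (h𝒱 : 𝒱.InjectiveCoreAnchor) {W : 𝒱.algV.Sections} {Y : 𝒱.algE.Sections}
    (h : 𝒱.IsLift W Y) : Y ∈ 𝒱.coreSections.normalizer := by
  rw [LieSubalgebra.mem_normalizer_iff']
  rintro X ⟨c, hc, hX⟩
  obtain ⟨Z, hZs, hZt⟩ := 𝒱.exists_right_invariant hc
  rw [𝒱.mem_coreSections_iff h𝒱]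
  intro x
  rw [← 𝒱.base.tgt_unit x, 𝒱.mem_coreImage_tgt_iff]
  refine ⟨⁅Z, W⁆ (𝒱.base.unit x), ?_, ?_⟩
  · rw [𝒱.srcMap_lie (X' := 0) (Y' := Y) hZs (fun k => (h k).1), zero_lie]
    rfl
  · exact 𝒱.tgtMap_lie (fun k => by rw [hZt, hX]) (fun k => (h k).2) _

section Basic

variable [FiniteDimensional ℝ FV] [FiniteDimensional ℝ FE]

/-- A section of `N₀` is basic over `g` if and only if its values at the source and the target of `g`
are the images of a single element of `N₁`. -/
theorem srcPullback_eq_tgtPullback_iff (l : ∀ x, 𝒱.N₀ x) (g : G) :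
    𝒱.srcPullback l g = 𝒱.tgtPullback l g ↔
      ∃ q : 𝒱.N₁ g, 𝒱.srcBar g q = l (𝒱.base.src g) ∧ 𝒱.tgtBar g q = l (𝒱.base.tgt g) := by
  simp only [VBGroupoid.srcPullback, VBGroupoid.tgtPullback]
  constructor
  · intro h
    refine ⟨_, LinearEquiv.apply_symm_apply (LinearEquiv.ofBijective _ (𝒱.srcBar_bijective g)) _, ?_⟩
    rw [h]
    exact LinearEquiv.apply_symm_apply (LinearEquiv.ofBijective _ (𝒱.tgtBar_bijective g)) _
  · rintro ⟨q, hs, ht⟩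
    exact ((LinearEquiv.symm_apply_eq _).2 hs.symm).trans
      ((LinearEquiv.symm_apply_eq _).2 ht.symm).symm

theorem exists_srcMap_tgtMap_eq_iff (Y : 𝒱.algE.Sections) (g : G) :
    (∃ v : V g, 𝒱.srcMap g v = Y (𝒱.base.src g) ∧ 𝒱.tgtMap g v = Y (𝒱.base.tgt g)) ↔
      𝒱.srcPullback (𝒱.toNormal Y).1 g = 𝒱.tgtPullback (𝒱.toNormal Y).1 g := by
  rw [srcPullback_eq_tgtPullback_iff]
  constructor
  · rintro ⟨v, hs, ht⟩
    exact ⟨Submodule.Quotient.mk v, congrArg Submodule.Quotient.mk hs,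
      congrArg Submodule.Quotient.mk ht⟩
  · rintro ⟨q, hs, ht⟩
    obtain ⟨v, rfl⟩ := Submodule.Quotient.mk_surjective _ q
    -- correct the source of `v` by an element of `ker t̃` and its target by one of `ker s̃`
    obtain ⟨a, hat, has⟩ := (𝒱.mem_coreImage_src_iff g _).1 ((Submodule.Quotient.eq _).1 hs)
    obtain ⟨b, hbs, hbt⟩ := (𝒱.mem_coreImage_tgt_iff g _).1 ((Submodule.Quotient.eq _).1 ht)
    exact ⟨v - a - b, by rw [map_sub, map_sub, has, hbs]; abel,
      by rw [map_sub, map_sub, hat, hbt]; abel⟩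

theorem toNormal_mem_basicSections_iff (h𝒱 : 𝒱.InjectiveCoreAnchor) (Y : 𝒱.algE.Sections) :
    𝒱.toNormal Y ∈ 𝒱.basicSections ↔ ∃ W, 𝒱.IsLift W Y := by
  constructor
  · intro h
    choose W hW using fun g => (𝒱.exists_srcMap_tgtMap_eq_iff Y g).2 (congrFun h g)
    refine ⟨(⟨W, ?_⟩ : Cₛ^∞⟮𝓘(ℝ, EG); FV, V⟯), hW⟩
    refine 𝒱.contMDiff_of_src_tgt contMDiff_id W ?_ ?_ (𝒱.eq_zero_of_srcMap_of_tgtMap h𝒱)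
    · exact (Y.contMDiff.comp 𝒱.isMorphism_src.contMDiff_base).congr fun g =>
        congrArg (TotalSpace.mk _) (hW g).1
    · exact (Y.contMDiff.comp 𝒱.isMorphism_tgt.contMDiff_base).congr fun g =>
        congrArg (TotalSpace.mk _) (hW g).2
  · rintro ⟨W, hW⟩
    exact funext fun g => (𝒱.exists_srcMap_tgtMap_eq_iff Y g).1 ⟨W g, hW g⟩

variable [FiniteDimensional ℝ EM] [T2Space M] [SigmaCompactSpace M]

theorem basicSections_le_flatSections (h𝒱 : 𝒱.InjectiveCoreAnchor) :
    𝒱.basicSections ≤ 𝒱.flatSections h𝒱 := by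
  intro l hl
  obtain ⟨Y, rfl⟩ := 𝒱.toNormal_surjective l
  obtain ⟨W, hW⟩ := (𝒱.toNormal_mem_basicSections_iff h𝒱 Y).1 hl
  exact (𝒱.toNormal_mem_flatSections_iff h𝒱 Y).2 (hW.mem_normalizer h𝒱)

/-- `Γ_bas(V)` as a Lie subalgebra of `Γ₀(E)`. -/
noncomputable def basicSubalgebra (h𝒱 : 𝒱.InjectiveCoreAnchor) :
    LieSubalgebra ℝ (𝒱.flatSections h𝒱) where
  __ := 𝒱.basicSections.comap (𝒱.flatSections h𝒱).subtype
  lie_mem' {l m} hl hm := by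
    obtain ⟨X, hX⟩ := 𝒱.toNormal_surjective l.1
    obtain ⟨Y, hY⟩ := 𝒱.toNormal_surjective m.1
    change l.1 ∈ 𝒱.basicSections at hl
    change m.1 ∈ 𝒱.basicSections at hm
    rw [← hX, 𝒱.toNormal_mem_basicSections_iff h𝒱] at hl
    rw [← hY, 𝒱.toNormal_mem_basicSections_iff h𝒱] at hm
    obtain ⟨W, hW⟩ := hl
    obtain ⟨W', hW'⟩ := hm
    change (⁅l, m⁆ : 𝒱.flatSections h𝒱).1 ∈ 𝒱.basicSections
    rw [𝒱.flat_lie_eq h𝒱 l m X Y hX hY, 𝒱.toNormal_mem_basicSections_iff h𝒱]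
    exact ⟨_, hW.lie hW'⟩

/-- The homomorphism of Lie algebras `N(Γ(C)) → Γ₀(E)`, `X ↦ X̄`. -/
noncomputable def normalizerToFlat (h𝒱 : 𝒱.InjectiveCoreAnchor) :
    𝒱.coreSections.normalizer →ₗ⁅ℝ⁆ 𝒱.flatSections h𝒱 where
  toFun X := ⟨𝒱.toNormal X, (𝒱.toNormal_mem_flatSections_iff h𝒱 X).2 X.2⟩
  map_add' X Y := Subtype.ext (map_add 𝒱.toNormal (X : 𝒱.algE.Sections) Y)
  map_smul' r X := Subtype.ext (map_smul 𝒱.toNormal r (X : 𝒱.algE.Sections))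
  map_lie' {X Y} := Subtype.ext (𝒱.flat_lie_eq h𝒱 _ _ X Y rfl rfl).symm

end Basic

end LAGroupoid

end LA

theorem mainTheorem4 {EG EM EG₂ FV FE FV₂ : Type*}
    [NormedAddCommGroup EG] [NormedSpace ℝ EG] [FiniteDimensional ℝ EG]
    [NormedAddCommGroup EM] [NormedSpace ℝ EM] [FiniteDimensional ℝ EM]
    [NormedAddCommGroup EG₂] [NormedSpace ℝ EG₂] [FiniteDimensional ℝ EG₂]
    [NormedAddCommGroup FV] [NormedSpace ℝ FV] [FiniteDimensional ℝ FV]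
    [NormedAddCommGroup FE] [NormedSpace ℝ FE] [FiniteDimensional ℝ FE]
    [NormedAddCommGroup FV₂] [NormedSpace ℝ FV₂] [FiniteDimensional ℝ FV₂]
    {G M G₂ : Type*}
    [TopologicalSpace G] [ChartedSpace EG G] [IsManifold 𝓘(ℝ, EG) ∞ G]
    [TopologicalSpace M] [ChartedSpace EM M] [IsManifold 𝓘(ℝ, EM) ∞ M]
    [T2Space M] [SigmaCompactSpace M]
    [TopologicalSpace G₂] [ChartedSpace EG₂ G₂] [IsManifold 𝓘(ℝ, EG₂) ∞ G₂]
    {V : G → Type*} {E : M → Type*} {V₂ : G₂ → Type*}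
    [TopologicalSpace (TotalSpace FV V)] [∀ g, TopologicalSpace (V g)]
    [∀ g, AddCommGroup (V g)] [∀ g, Module ℝ (V g)] [FiberBundle FV V]
    [VectorBundle ℝ FV V] [ContMDiffVectorBundle ∞ FV V 𝓘(ℝ, EG)]
    [TopologicalSpace (TotalSpace FE E)] [∀ x, TopologicalSpace (E x)]
    [∀ x, AddCommGroup (E x)] [∀ x, Module ℝ (E x)] [FiberBundle FE E]
    [VectorBundle ℝ FE E] [ContMDiffVectorBundle ∞ FE E 𝓘(ℝ, EM)]
    [TopologicalSpace (TotalSpace FV₂ V₂)] [∀ p, TopologicalSpace (V₂ p)]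
    [∀ p, AddCommGroup (V₂ p)] [∀ p, Module ℝ (V₂ p)] [FiberBundle FV₂ V₂]
    [VectorBundle ℝ FV₂ V₂] [ContMDiffVectorBundle ∞ FV₂ V₂ 𝓘(ℝ, EG₂)]
    (𝒱 : LAGroupoid EG EM EG₂ FV FE FV₂ V E V₂) (h𝒱 : 𝒱.InjectiveCoreAnchor) :
    (∃ φ : (𝒱.coreSections.normalizer ⧸ 𝒱.coreIdeal) ≃ₗ⁅ℝ⁆ 𝒱.flatSections h𝒱,
      ∀ X : 𝒱.coreSections.normalizer,
        (φ (LieSubmodule.Quotient.mk X) : 𝒱.normalSections) = 𝒱.toNormal X) ∧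
    𝒱.basicSections ≤ 𝒱.flatSections h𝒱 ∧
    ∃ S : LieSubalgebra ℝ (𝒱.flatSections h𝒱),
      ∀ l : 𝒱.flatSections h𝒱, l ∈ S ↔ (l : 𝒱.normalSections) ∈ 𝒱.basicSections := by
  refine ⟨?_, 𝒱.basicSections_le_flatSections h𝒱, 𝒱.basicSubalgebra h𝒱, fun l => Iff.rfl⟩
  obtain ⟨φ, hφ⟩ := (𝒱.normalizerToFlat h𝒱).exists_quotient_equiv_of_surjective
    (fun l => (𝒱.exists_toNormal_eq h𝒱 l).imp fun X hX => Subtype.ext hX) 𝒱.coreIdeal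
    (fun X => (𝒱.toNormal_eq_zero_iff h𝒱 X).symm.trans
      (Subtype.ext_iff (a1 := 𝒱.normalizerToFlat h𝒱 X) (a2 := 0)).symm)
  exact ⟨φ, fun X => congrArg Subtype.val (hφ X)⟩
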